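/- \textbf{Model.} Let $U$, $V_P$, $V_A$ be finite sets and $V=V_P\sqcup V_A$. $G=(U,V,E)$ is a bipartite graph with offline side $U$ and online side $V$; the nodes of $V_P$ are \emph{predicted}, those of $V_A$ \emph{adversarial}, and $H$ is the subgraph of $G$ induced on $U\cup V_P$. No matching condition is imposed on $G$ or $H$. The algorithm knows $H$ in advance. The nodes of $V$ arrive one at a time in an arbitrary order (predicted and adversarial nodes may be interleaved); when $v$ arrives its incident edges are revealed (and a predicted node is recognized as such), and the algorithm must irrevocably choose the values $x_{uv}\ge 0$ on the edges at $v$, depending only on $H$ and on what has been revealed so far. The result must be a fractional matching: $x\ge 0$ on edges and $0$ elsewhere, and every node $w\in U\cup V$ has fractional degree (sum of the values on its edges) at most $1$. Let $\mathrm{OPT}(G)$ be the maximum of $\sum_e x_e$ over all fractional matchings of $G$, let $\nu(\cdot)$ be the size of a maximum matching, and let $\delta=1-\nu(H)/\nu(G)$ (with $\delta=1$ if $\nu(G)=0$). Write $\Gamma(X)$ for the set of neighbours of $X$. \textbf{Skeleton decomposition.} A skeleton decomposition of $H$ consists of integers $a\le 0\le b$ and partitions $V_P=S_{-\infty}\sqcup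 S_a\sqcup\dots\sqcup S_b$ and $U=T_a\sqcup\dots\sqcup T_b\sqcup T_\infty$, where $S_i,T_i$ are non-empty for $i\neq 0$ ($S_0=T_0=\emptyset$ is allowed, and the ratio $|S_0|/|T_0|$ is then taken to be $1$), such that the nodes of $S_{-\infty}$ and $T_\infty$ have degree $0$ in $H$; $\Gamma(\bigcup_{i<j}S_i)=\bigcup_{i<j}T_i$ in $H$ for all $j$; and $$\tfrac{|S_a|}{|T_a|}>\dots>\tfrac{|S_{-1}|}{|T_{-1}|}>\tfrac{|S_0|}{|T_0|}=1>\tfrac{|S_1|}{|T_1|}>\dots>\tfrac{|S_b|}{|T_b|}.$$ A fractional matching $x^0$ of $H$ is \emph{balanced} for it if nodes of $S_i$ are matched only with nodes of $T_i$ and vice versa; for $i\ge 0$ each node of $S_i$ has fractional degree $1$ and each node of $T_i$ has fractional degree $|S_i|/|T_i|$; and for $i<0$ each node of $T_i$ has fractional degree $1$ and each node of $S_i$ has fractional degree $|T_i|/|S_i|$. \textbf{Algorithm $\mathrm{ALG}$.} Preprocessing: compute a skeleton decomposition of $H$ and a balanced fractional matching $x^0$, and set the initial levels $y_u=\sum_{v\in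 V_P}x^0_{uv}$. Online phase: an arriving predicted node $v$ is assigned the values $x^0_{uv}$. An arriving adversarial node $v$ is processed by water-filling: its neighbours of least current level are raised at a uniform rate until $v$ has been matched to a total of $1$ or all its neighbours have level $1$. That is, with $z\in[0,1]$ the largest number such that $\sum_{u\in\Gamma(v)}\max(0,z-y_u)\le 1$, set $x_{uv}=\max(0,z-y_u)$ and increase $y_u$ by $x_{uv}$ for every $u\in\Gamma(v)$. \textbf{Theorem.} The graph $H$ has a skeleton decomposition with a balanced fractional matching, so $\mathrm{ALG}$ is well defined. For every choice of these in the preprocessing phase, every graph $G$ as above whose predicted graph is $H$, and every arrival order, the output $x$ of $\mathrm{ALG}$ is a fractional matching of $G$ and $$\sum_{e\in E}x_e\;\ge\;\bigl(1-\delta e^{-\delta}\bigr)\cdot\mathrm{OPT}(G).$$ -/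

import Mathlib

/-! Bipartite graphs with offline side `U` and online side `V` (both finite) are given by the
neighbourhood map `Γ : V → Finset U`; the edges are the pairs `(u, v)` with `u ∈ Γ v`. -/

namespace SemiOnline

section Matchings

variable {U V : Type*}

/-- `M` is an (integral) matching of the bipartite graph `Γ`: a set of edges, no two of which
share an endpoint. -/
def IsMatching (Γ : V → Finset U) (M : Finset (U × V)) : Prop :=
  (∀ e ∈ M, e.1 ∈ Γ e.2) ∧
  ∀ e ∈ M, ∀ e' ∈ M, e ≠ e' → e.1 ≠ e'.1 ∧ e.2 ≠ e'.2

/-- `ν(Γ)`, the size of a maximum matching. -/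
noncomputable def matchingNumber (Γ : V → Finset U) : ℕ :=
  sSup {k : ℕ | ∃ M : Finset (U × V), IsMatching Γ M ∧ M.card = k}

variable [Fintype U] [Fintype V]

/-- `x` is a fractional matching of `Γ`: nonnegative, supported on the edges, with all
fractional degrees at most `1`. -/
structure IsFractionalMatching (Γ : V → Finset U) (x : U → V → ℝ) : Prop where
  nonneg : ∀ u v, 0 ≤ x u v
  support : ∀ u v, u ∉ Γ v → x u v = 0
  degree_offline : ∀ u, ∑ v, x u v ≤ 1
  degree_online : ∀ v, ∑ u, x u v ≤ 1

/-- The size `∑ₑ xₑ` of a fractional matching. -/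
def value (x : U → V → ℝ) : ℝ := ∑ u, ∑ v, x u v

/-- `OPT(Γ)`: the largest size of a fractional matching of `Γ`. -/
noncomputable def fractionalOpt (Γ : V → Finset U) : ℝ :=
  sSup {r : ℝ | ∃ x : U → V → ℝ, IsFractionalMatching Γ x ∧ value x = r}

end Matchings

section Skeleton

variable {U VP : Type*}

/-- A skeleton decomposition of the predicted graph `H`: the online side is partitioned into
`Sbot = S_{-∞}` and `S a, …, S b`, the offline side into `T a, …, T b` and `Ttop = T_∞`.
Only the pair with index `0` may be empty, and its ratio is `1` by convention.
The balanced fractional matching that comes with it is `Skeleton.IsBalanced` below. -/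
structure Skeleton (H : VP → Finset U) where
  a : ℤ
  b : ℤ
  S : ℤ → Finset VP
  T : ℤ → Finset U
  Sbot : Finset VP
  Ttop : Finset U
  a_nonpos : a ≤ 0
  b_nonneg : 0 ≤ b
  /- the parts with indices outside `[a, b]` do not exist -/
  S_outside : ∀ i, i < a ∨ b < i → S i = ∅
  T_outside : ∀ i, i < a ∨ b < i → T i = ∅
  S_nonempty : ∀ i, a ≤ i → i ≤ b → i ≠ 0 → (S i).Nonempty
  T_nonempty : ∀ i, a ≤ i → i ≤ b → i ≠ 0 → (T i).Nonempty
  /- the two partitions -/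
  S_disjoint : ∀ i j, i ≠ j → Disjoint (S i) (S j)
  T_disjoint : ∀ i j, i ≠ j → Disjoint (T i) (T j)
  Sbot_disjoint : ∀ i, Disjoint Sbot (S i)
  Ttop_disjoint : ∀ i, Disjoint Ttop (T i)
  S_cover : ∀ v, v ∈ Sbot ∨ ∃ i, v ∈ S i
  T_cover : ∀ u, u ∈ Ttop ∨ ∃ i, u ∈ T i
  /- the nodes of `Sbot` and `Ttop` have degree zero -/
  Sbot_isolated : ∀ v ∈ Sbot, H v = ∅
  Ttop_isolated : ∀ u ∈ Ttop, ∀ v, u ∉ H v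
  /- the neighbourhood of `⋃_{i < j} S i` is `⋃_{i < j} T i` -/
  neighbours : ∀ (j : ℤ) (u : U),
    (∃ i, i < j ∧ ∃ v ∈ S i, u ∈ H v) ↔ ∃ i, i < j ∧ u ∈ T i
  /- the ratios `|S i| / |T i|` decrease strictly, and the one with index `0` is `1` -/
  card_zero : (S 0).card = (T 0).card
  ratio_gt_one : ∀ i, a ≤ i → i < 0 → 1 < ((S i).card : ℝ) / (T i).card
  ratio_lt_one : ∀ i, 0 < i → i ≤ b → ((S i).card : ℝ) / (T i).card < 1
  ratio_strictAnti : ∀ i j, a ≤ i → i < j → j ≤ b → i ≠ 0 → j ≠ 0 →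
    ((S j).card : ℝ) / (T j).card < ((S i).card : ℝ) / (T i).card

/-- `x₀` is a fractional matching of `H` as provided by the skeleton decomposition `D`. -/
structure Skeleton.IsBalanced [Fintype U] [Fintype VP] {H : VP → Finset U} (D : Skeleton H)
    (x₀ : U → VP → ℝ) : Prop where
  isFractionalMatching : IsFractionalMatching H x₀
  degree_S_of_nonneg : ∀ i, 0 ≤ i → ∀ v ∈ D.S i, ∑ u, x₀ u v = 1
  degree_T_of_nonneg : ∀ i, 0 ≤ i → ∀ u ∈ D.T i,
    ∑ v, x₀ u v = ((D.S i).card : ℝ) / (D.T i).card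
  degree_T_of_neg : ∀ i, i < 0 → ∀ u ∈ D.T i, ∑ v, x₀ u v = 1
  degree_S_of_neg : ∀ i, i < 0 → ∀ v ∈ D.S i,
    ∑ u, x₀ u v = ((D.T i).card : ℝ) / (D.S i).card
  within_parts : ∀ u v, x₀ u v ≠ 0 → ∃ i, u ∈ D.T i ∧ v ∈ D.S i

end Skeleton

section Model

variable {U VP VA : Type*}

/-- What the algorithm sees when an online node arrives: either that it is the predicted node
`p` (whose neighbours it knows already), or the set of neighbours of an adversarial node. -/
abbrev Arrival (U VP : Type*) := VP ⊕ Finset U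

/-- A deterministic online rule: from the list of the earlier arrivals (oldest first) and the
current arrival, it computes the fractional values put on the edges of the current node. -/
abbrev OnlineRule (U VP : Type*) := List (Arrival U VP) → Arrival U VP → U → ℝ

/-- The arrival seen when `v` is revealed; `K` gives the neighbours of the adversarial nodes. -/
def reveal (K : VA → Finset U) (v : VP ⊕ VA) : Arrival U VP := Sum.map id K v

/-- The assignment produced by an online rule when the nodes arrive in the order `l`:
the values at `v` are computed from the arrivals before `v` and from that of `v`. -/
def run [DecidableEq VP] [DecidableEq VA] (π : OnlineRule U VP) (K : VA → Finset U)
    (l : List (VP ⊕ VA)) (u : U) (v : VP ⊕ VA) : ℝ :=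
  π ((l.takeWhile (fun w => decide (w ≠ v))).map (reveal K)) (reveal K v) u

end Model

section Algorithm

variable {U VP : Type*}

/-- The common water level reached when one unit is poured over the neighbours `N`, whose
current levels are `y`: all neighbours below `z` are raised to `z`, where `z ≤ 1` is as large
as possible with at most one unit poured. -/
noncomputable def waterLevel (N : Finset U) (y : U → ℝ) : ℝ :=
  sSup {z : ℝ | 0 ≤ z ∧ z ≤ 1 ∧ ∑ u ∈ N, max 0 (z - y u) ≤ 1}

variable [DecidableEq U]

/-- The water-filling step: the neighbours in `N` of least level are raised at a uniform rate
until one unit is used up or all of them are at level `1`; these are the amounts received. -/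
noncomputable def waterFill (N : Finset U) (y : U → ℝ) (u : U) : ℝ :=
  if u ∈ N then max 0 (waterLevel N y - y u) else 0

/-- The update of the levels `y` at an arrival. Predicted nodes are accounted for in the initial
levels. -/
noncomputable def levelStep (y : U → ℝ) : Arrival U VP → U → ℝ
  | Sum.inl _ => y
  | Sum.inr N => fun u => y u + waterFill N y u

/-- The algorithm with preprocessed fractional matching `x₀` of the predicted graph: predicted
nodes are assigned by `x₀` whenever they arrive, adversarial nodes by water-filling on top of
the levels given by `x₀` and the earlier adversarial nodes. -/
noncomputable def alg [Fintype VP] (x₀ : U → VP → ℝ) : OnlineRule U VP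
  | _, Sum.inl p => fun u => x₀ u p
  | past, Sum.inr N => waterFill N (past.foldl levelStep (fun u => ∑ p, x₀ u p))

end Algorithm

/-- The graph `G` with predicted part `H` and adversarial part `K`. -/
abbrev fullGraph {U VP VA : Type*} (H : VP → Finset U) (K : VA → Finset U) :
    VP ⊕ VA → Finset U := Sum.elim H K

/-- `δ = 1 - ν(H) / ν(G)`. (If `ν(G) = 0`, this is `1`.) -/
noncomputable def delta {U VP VA : Type*} (H : VP → Finset U) (K : VA → Finset U) : ℝ :=
  1 - (matchingNumber H : ℝ) / (matchingNumber (fullGraph H K) : ℝ)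

end SemiOnline

/-! Write `n = ν(G)`, let `y₀` and `y` be the initial and final levels, and `s = ∑ y₀`. The output
has value `∑ y` (`sum_run_eq_levels`), a balanced matching is maximum so `s = ν(H)`, and `OPT(G) ≤
n` by Kőnig. Since `δ = 1 - s/n`, it remains to show `∑ y ≥ n - (n - s) e^{-(1 - s/n)}`.

The combinatorial input is `matchingNumber_le_levels`. Fix a height `t < 1`. The offline nodes of
final level above `t`, together with the online neighbours of the other offline nodes, cover all
edges. Each of these online nodes is fully matched: a predicted one into offline nodes of initial
level at most `t`, by the monotone ratios of the skeleton; an adversarial one entirely below height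
`t`, because its water level was at most `t`. Counting their mass gives `n ≤ Y'(t) + Y(t) - t · #{y₀
> t}`, where `Y(t) = ∑ min(y, t)` and `Y'` is its right derivative.

The analytic input is `le_sum_levels`: multiply by `e^t` and integrate up to `t = 1`. Integrating
from `0` would be wasteful, since many nodes of small initial level, possibly more than `n`,
contribute almost nothing. Integration therefore starts at the point `τ` where the tangent from `(1,
n)` touches `∑ min(y₀, t)`. Its slope `γ` satisfies `#{y₀ > τ} ≤ γ ≤ n`, and convexity of `(y - 1)
e^y` then yields the bound.

Existence of the skeleton (`exists_skeleton_isBalanced`) comes from an assignment of unit online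
mass minimising the sum of squared offline loads: its load classes are the parts, and scaling it
down yields the balanced matching. -/

namespace SemiOnline

/-! ### Matchings, vertex covers and Kőnig's theorem -/

section Covers

variable {U V : Type*}

/-- A matching is at most as large as any vertex cover. -/
theorem IsMatching.card_le_cover {Γ : V → Finset U} {M : Finset (U × V)}
    (hM : IsMatching Γ M) (A : Finset U) (B : Finset V)
    (hcov : ∀ v, ∀ u ∈ Γ v, u ∈ A ∨ v ∈ B) : M.card ≤ A.card + B.card := by
  classical
  have hsub : M ⊆ M.filter (fun e => e.1 ∈ A) ∪ M.filter (fun e => e.2 ∈ B) := by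
    intro e he
    rcases hcov e.2 e.1 (hM.1 e he) with h | h
    · exact Finset.mem_union_left _ (Finset.mem_filter.2 ⟨he, h⟩)
    · exact Finset.mem_union_right _ (Finset.mem_filter.2 ⟨he, h⟩)
  refine (Finset.card_le_card hsub).trans ((Finset.card_union_le _ _).trans ?_)
  refine add_le_add (Finset.card_le_card_of_injOn Prod.fst ?_ ?_)
    (Finset.card_le_card_of_injOn Prod.snd ?_ ?_)
  · intro e he
    exact (Finset.mem_filter.1 he).2
  · intro e he e' he' h
    by_contra hne
    exact (hM.2 e (Finset.mem_filter.1 he).1 e' (Finset.mem_filter.1 he').1 hne).1 h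
  · intro e he
    exact (Finset.mem_filter.1 he).2
  · intro e he e' he' h
    by_contra hne
    exact (hM.2 e (Finset.mem_filter.1 he).1 e' (Finset.mem_filter.1 he').1 hne).2 h

theorem isMatching_empty (Γ : V → Finset U) : IsMatching Γ ∅ := by
  simp [IsMatching]

theorem exists_isMatching_card_eq_matchingNumber [Fintype V] (Γ : V → Finset U) :
    ∃ M : Finset (U × V), IsMatching Γ M ∧ M.card = matchingNumber Γ := by
  refine Nat.sSup_mem (s := {k : ℕ | ∃ M : Finset (U × V), IsMatching Γ M ∧ M.card = k})
    ⟨0, ∅, isMatching_empty Γ, rfl⟩ ⟨Fintype.card V, ?_⟩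
  rintro k ⟨M, hM, rfl⟩
  simpa using hM.card_le_cover ∅ Finset.univ (by simp)

theorem IsMatching.card_le_matchingNumber [Fintype V] {Γ : V → Finset U} {M : Finset (U × V)}
    (hM : IsMatching Γ M) : M.card ≤ matchingNumber Γ := by
  refine le_csSup ⟨Fintype.card V, ?_⟩ ⟨M, hM, rfl⟩
  rintro k ⟨M, hM, rfl⟩
  simpa using hM.card_le_cover ∅ Finset.univ (by simp)

theorem matchingNumber_le_cover [Fintype V] (Γ : V → Finset U) (A : Finset U) (B : Finset V)
    (hcov : ∀ v, ∀ u ∈ Γ v, u ∈ A ∨ v ∈ B) : matchingNumber Γ ≤ A.card + B.card := by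
  obtain ⟨M, hM, hc⟩ := exists_isMatching_card_eq_matchingNumber Γ
  exact hc ▸ hM.card_le_cover A B hcov

/-- A fractional matching is at most as large as any vertex cover. -/
theorem IsFractionalMatching.value_le_cover [Fintype U] [Fintype V]
    {Γ : V → Finset U} {x : U → V → ℝ}
    (hx : IsFractionalMatching Γ x) (A : Finset U) (B : Finset V)
    (hcov : ∀ v, ∀ u ∈ Γ v, u ∈ A ∨ v ∈ B) : value x ≤ A.card + B.card := by
  classical
  have h1 : value x ≤ ∑ u, ∑ v, ((if u ∈ A then x u v else 0) + (if v ∈ B then x u v else 0)) := by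
    refine Finset.sum_le_sum fun u _ => Finset.sum_le_sum fun v _ => ?_
    have h0 := hx.nonneg u v
    by_cases he : u ∈ Γ v
    · rcases hcov v u he with h | h
      · simp only [h, if_true]; split_ifs <;> linarith
      · simp only [h, if_true]; split_ifs <;> linarith
    · rw [hx.support u v he]; simp
  have h2 : ∑ u, ∑ v, (if u ∈ A then x u v else 0) ≤ A.card := by
    calc ∑ u, ∑ v, (if u ∈ A then x u v else 0) ≤ ∑ u, (if u ∈ A then (1 : ℝ) else 0) := by
          refine Finset.sum_le_sum fun u _ => ?_
          split_ifs
          · exact hx.degree_offline u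
          · simp
      _ = A.card := by simp
  have h3 : ∑ u, ∑ v, (if v ∈ B then x u v else 0) ≤ B.card := by
    rw [Finset.sum_comm]
    calc ∑ v, ∑ u, (if v ∈ B then x u v else 0) ≤ ∑ v, (if v ∈ B then (1 : ℝ) else 0) := by
          refine Finset.sum_le_sum fun v _ => ?_
          split_ifs
          · exact hx.degree_online v
          · simp
      _ = B.card := by simp
  simp only [Finset.sum_add_distrib] at h1
  linarith

/-- Kőnig's theorem: some vertex cover is at most as large as a maximum matching. -/
theorem exists_cover_card_le_matchingNumber [Fintype V] (Γ : V → Finset U) :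
    ∃ (A : Finset U) (B : Finset V), (∀ v, ∀ u ∈ Γ v, u ∈ A ∨ v ∈ B) ∧
      A.card + B.card ≤ matchingNumber Γ := by
  classical
  -- `S` has the largest deficiency `d = |S| - |Γ(S)|`; the cover `Γ(S) ∪ Sᶜ` then has size `|V| -
  -- d`.
  obtain ⟨S, -, hS⟩ := Finset.exists_max_image (Finset.univ : Finset (Finset V))
    (fun S => (S.card : ℤ) - (S.biUnion Γ).card) ⟨∅, Finset.mem_univ _⟩
  set d : ℕ := S.card - (S.biUnion Γ).card with hd
  have hpos : (S.biUnion Γ).card ≤ S.card := by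
    have := hS ∅ (Finset.mem_univ _)
    simp only [Finset.card_empty, Finset.biUnion_empty] at this
    omega
  refine ⟨S.biUnion Γ, Sᶜ, fun v u hu => ?_, ?_⟩
  · by_cases hv : v ∈ S
    · exact Or.inl (Finset.mem_biUnion.2 ⟨v, hv, hu⟩)
    · exact Or.inr (Finset.mem_compl.2 hv)
  -- With `d` dummy offline nodes adjacent to everything, Hall's condition holds. At most `d` online
  -- nodes go to dummies, so at least `|V| - d` are matched by real edges.
  let t : V → Finset (U ⊕ Fin d) := fun v => (Γ v).disjSum Finset.univ
  have hall : ∀ X : Finset V, X.card ≤ (X.biUnion t).card := by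
    intro X
    rcases X.eq_empty_or_nonempty with rfl | ⟨v, hv⟩
    · simp
    have hX := hS X (Finset.mem_univ _)
    have hsub : (X.biUnion Γ).disjSum (Finset.univ : Finset (Fin d)) ⊆ X.biUnion t := by
      intro w hw
      rcases w with u | k
      · obtain ⟨v', hv', hu⟩ := Finset.mem_biUnion.1 (Finset.inl_mem_disjSum.1 hw)
        exact Finset.mem_biUnion.2 ⟨v', hv', Finset.inl_mem_disjSum.2 hu⟩
      · exact Finset.mem_biUnion.2 ⟨v, hv, Finset.inr_mem_disjSum.2 (Finset.mem_univ _)⟩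
    have := Finset.card_le_card hsub
    rw [Finset.card_disjSum, Finset.card_univ, Fintype.card_fin] at this
    omega
  obtain ⟨f, hf, hft⟩ := (Finset.all_card_le_biUnion_card_iff_exists_injective t).1 hall
  let W : Finset V := Finset.univ.filter fun v => (f v).isLeft
  let g : V → Option (U × V) := fun v => (f v).getLeft?.map fun u => (u, v)
  let M : Finset (U × V) := W.biUnion fun v => (g v).toFinset
  have hmem : ∀ e : U × V, e ∈ M ↔ f e.2 = Sum.inl e.1 := by
    rintro ⟨u, v⟩
    simp only [M, W, g, Finset.mem_biUnion, Finset.mem_filter, Finset.mem_univ, true_and,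
      Option.mem_toFinset, Option.mem_def, Option.map_eq_some_iff, Prod.mk.injEq,
      Sum.getLeft?_eq_some_iff]
    constructor
    · rintro ⟨v', -, u', h, rfl, rfl⟩
      exact h
    · intro h
      exact ⟨v, by simp [h], u, h, rfl, rfl⟩
  have hM : IsMatching Γ M := by
    refine ⟨fun e he => ?_, fun e he e' he' hne => ?_⟩
    · have := hft e.2
      rw [(hmem e).1 he] at this
      exact Finset.inl_mem_disjSum.1 this
    · have h1 := (hmem e).1 he
      have h2 := (hmem e').1 he'
      have key : e.2 ≠ e'.2 := fun h => hne (Prod.ext (Sum.inl_injective (by rw [← h1, ← h2, h])) h)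
      exact ⟨fun h => key (hf (by rw [h1, h2, h])), key⟩
  have hWM : W.card ≤ M.card := by
    refine (Finset.card_le_card (t := M.image Prod.snd) fun v hv => ?_).trans Finset.card_image_le
    obtain ⟨u, hu⟩ := Sum.isLeft_iff.1 (Finset.mem_filter.1 hv).2
    exact Finset.mem_image.2 ⟨(u, v), (hmem (u, v)).2 hu, rfl⟩
  have hWc : Wᶜ.card ≤ d := by
    have : (Wᶜ.image f).card ≤ (Finset.univ.map (Function.Embedding.inr : Fin d ↪ U ⊕ Fin d)).card := by
      refine Finset.card_le_card fun w hw => ?_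
      obtain ⟨v, hv, rfl⟩ := Finset.mem_image.1 hw
      have hv' : ¬ (f v).isLeft := fun h => Finset.mem_compl.1 hv (Finset.mem_filter.2 ⟨Finset.mem_univ _, h⟩)
      rcases h : f v with u | k
      · simp [h] at hv'
      · simp
    rwa [Finset.card_image_of_injective _ hf, Finset.card_map, Finset.card_univ,
      Fintype.card_fin] at this
  have := hM.card_le_matchingNumber
  have h1 := Finset.card_compl_add_card W
  have h2 := Finset.card_compl_add_card S
  omega

theorem IsFractionalMatching.value_le_matchingNumber [Fintype U] [Fintype V]
    {Γ : V → Finset U} {x : U → V → ℝ} (hx : IsFractionalMatching Γ x) :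
    value x ≤ matchingNumber Γ := by
  obtain ⟨A, B, hcov, hcard⟩ := exists_cover_card_le_matchingNumber Γ
  exact (hx.value_le_cover A B hcov).trans (by exact_mod_cast hcard)

theorem fractionalOpt_le_matchingNumber [Fintype U] [Fintype V] (Γ : V → Finset U) :
    fractionalOpt Γ ≤ matchingNumber Γ := by
  refine Real.sSup_le ?_ (Nat.cast_nonneg _)
  rintro r ⟨x, hx, rfl⟩
  exact hx.value_le_matchingNumber

end Covers


/-! ### Indexing of the ratios and an assignment of least squared load -/

section SkeletonExistence

/-- For `1 ≤ k ≤ #A`, some element of `A` has exactly `k` elements of `A` above or equal in the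
total order `r`. -/
theorem exists_card_filter_rel_eq {α : Type*} (r : α → α → Prop) [DecidableRel r]
    [IsLinearOrder α r] (A : Finset α) (k : ℕ) (hk : 1 ≤ k)
    (hkA : k ≤ A.card) : ∃ ρ ∈ A, (A.filter fun σ => r ρ σ).card = k := by
  have key : ∀ x ∈ A, ∀ y ∈ A, r x y →
      (A.filter fun σ => r x σ).card = (A.filter fun σ => r y σ).card → x = y := by
    intro x hx y _ hxy hcard
    have hsub : (A.filter fun σ => r y σ) ⊆ A.filter fun σ => r x σ :=
      Finset.monotone_filter_right _ fun z _ hz => _root_.trans hxy hz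
    have : x ∈ A.filter fun σ => r y σ :=
      Finset.eq_of_subset_of_card_le hsub hcard.le ▸ Finset.mem_filter.2 ⟨hx, refl_of r x⟩
    exact antisymm_of r hxy (Finset.mem_filter.1 this).2
  have hinj : ∀ x y, ∀ _ : x ∈ A, ∀ _ : y ∈ A,
      (A.filter fun σ => r x σ).card = (A.filter fun σ => r y σ).card → x = y := by
    intro x y hx hy h
    rcases total_of r x y with h' | h'
    · exact key x hx y hy h' h
    · exact (key y hy x hx h' h.symm).symm
  have hmaps : ∀ ρ ∈ A, (A.filter fun σ => r ρ σ).card ∈ Finset.Icc 1 A.card := fun ρ hρ =>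
    Finset.mem_Icc.2 ⟨Finset.card_pos.2 ⟨ρ, Finset.mem_filter.2 ⟨hρ, refl_of r ρ⟩⟩,
      Finset.card_le_card (Finset.filter_subset _ _)⟩
  -- An injection of `A` into an interval of the same cardinality is onto.
  obtain ⟨ρ, hρ, h⟩ := Finset.surj_on_of_inj_on_of_card_le (s := A) (t := Finset.Icc 1 A.card)
    (fun ρ _ => (A.filter fun σ => r ρ σ).card) hmaps hinj (by simp) k (Finset.mem_Icc.2 ⟨hk, hkA⟩)
  exact ⟨ρ, hρ, h.symm⟩

/-- The position of `ρ` in the decreasing enumeration of `R` in which `1` has position `0`. -/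
noncomputable def ratioIndex (R : Finset ℝ) (ρ : ℝ) : ℤ :=
  ((R.filter fun σ => ρ ≤ σ ∧ σ < 1).card : ℤ) - (R.filter fun σ => 1 < σ ∧ σ ≤ ρ).card

theorem ratioIndex_antitone (R : Finset ℝ) : Antitone (ratioIndex R) := by
  intro ρ ρ' h
  have h1 : (R.filter fun σ => ρ' ≤ σ ∧ σ < 1).card ≤ (R.filter fun σ => ρ ≤ σ ∧ σ < 1).card :=
    Finset.card_le_card (Finset.monotone_filter_right _ fun z _ hz => ⟨h.trans hz.1, hz.2⟩)
  have h2 : (R.filter fun σ => 1 < σ ∧ σ ≤ ρ).card ≤ (R.filter fun σ => 1 < σ ∧ σ ≤ ρ').card :=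
    Finset.card_le_card (Finset.monotone_filter_right _ fun z _ hz => ⟨hz.1, hz.2.trans h⟩)
  unfold ratioIndex
  omega

theorem ratioIndex_one (R : Finset ℝ) : ratioIndex R 1 = 0 := by
  have h1 : (R.filter fun σ => 1 ≤ σ ∧ σ < 1) = ∅ :=
    Finset.filter_eq_empty_iff.2 fun z _ hz => hz.1.not_gt hz.2
  have h2 : (R.filter fun σ => 1 < σ ∧ σ ≤ 1) = ∅ :=
    Finset.filter_eq_empty_iff.2 fun z _ hz => hz.2.not_gt hz.1
  simp [ratioIndex, h1, h2]

theorem ratioIndex_of_le_one (R : Finset ℝ) {ρ : ℝ} (h : ρ ≤ 1) :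
    ratioIndex R ρ = (R.filter fun σ => ρ ≤ σ ∧ σ < 1).card := by
  have h2 : (R.filter fun σ => 1 < σ ∧ σ ≤ ρ) = ∅ :=
    Finset.filter_eq_empty_iff.2 fun z _ hz => (hz.2.trans h).not_gt hz.1
  simp [ratioIndex, h2]

theorem ratioIndex_of_one_le (R : Finset ℝ) {ρ : ℝ} (h : 1 ≤ ρ) :
    ratioIndex R ρ = -((R.filter fun σ => 1 < σ ∧ σ ≤ ρ).card : ℤ) := by
  have h1 : (R.filter fun σ => ρ ≤ σ ∧ σ < 1) = ∅ :=
    Finset.filter_eq_empty_iff.2 fun z _ hz => (h.trans hz.1).not_gt hz.2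
  simp [ratioIndex, h1]

theorem ratioIndex_pos (R : Finset ℝ) {ρ : ℝ} (hρ : ρ ∈ R) (h : ρ < 1) : 0 < ratioIndex R ρ := by
  rw [ratioIndex_of_le_one R h.le]
  have : 0 < (R.filter fun σ => ρ ≤ σ ∧ σ < 1).card :=
    Finset.card_pos.2 ⟨ρ, Finset.mem_filter.2 ⟨hρ, le_rfl, h⟩⟩
  exact_mod_cast this

theorem ratioIndex_neg (R : Finset ℝ) {ρ : ℝ} (hρ : ρ ∈ R) (h : 1 < ρ) : ratioIndex R ρ < 0 := by
  rw [ratioIndex_of_one_le R h.le, neg_lt_zero]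
  have : 0 < (R.filter fun σ => 1 < σ ∧ σ ≤ ρ).card :=
    Finset.card_pos.2 ⟨ρ, Finset.mem_filter.2 ⟨hρ, h, le_rfl⟩⟩
  exact_mod_cast this

theorem ratioIndex_nonneg_iff (R : Finset ℝ) {ρ : ℝ} (hρ : ρ ∈ R) : 0 ≤ ratioIndex R ρ ↔ ρ ≤ 1 := by
  constructor
  · intro h
    by_contra h1
    exact absurd (ratioIndex_neg R hρ (not_le.1 h1)) (not_lt.2 h)
  · intro h
    exact ratioIndex_one R ▸ ratioIndex_antitone R h

theorem ratioIndex_nonpos_iff (R : Finset ℝ) {ρ : ℝ} (hρ : ρ ∈ R) : ratioIndex R ρ ≤ 0 ↔ 1 ≤ ρ := by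
  constructor
  · intro h
    by_contra h1
    exact absurd (ratioIndex_pos R hρ (not_le.1 h1)) (not_lt.2 h)
  · intro h
    exact ratioIndex_one R ▸ ratioIndex_antitone R h

theorem ratioIndex_injOn (R : Finset ℝ) : Set.InjOn (ratioIndex R) R := by
  have key : ∀ ρ ∈ R, ∀ ρ' ∈ R, ρ < ρ' → ratioIndex R ρ ≠ ratioIndex R ρ' := by
    intro ρ hρ ρ' hρ' hlt h
    rcases le_or_gt ρ' 1 with h1 | h1
    · rw [ratioIndex_of_le_one R h1, ratioIndex_of_le_one R (hlt.le.trans h1), Nat.cast_inj] at h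
      have hsub : (R.filter fun σ => ρ' ≤ σ ∧ σ < 1) ⊆ (R.filter fun σ => ρ ≤ σ ∧ σ < 1) :=
        Finset.monotone_filter_right _ fun z _ hz => ⟨hlt.le.trans hz.1, hz.2⟩
      have : ρ ∈ R.filter fun σ => ρ' ≤ σ ∧ σ < 1 :=
        Finset.eq_of_subset_of_card_le hsub h.le ▸
          Finset.mem_filter.2 ⟨hρ, le_rfl, hlt.trans_le h1⟩
      exact (Finset.mem_filter.1 this).2.1.not_gt hlt
    · have hneg := ratioIndex_neg R hρ' h1
      rw [← h] at hneg
      have h1' : 1 ≤ ρ := (ratioIndex_nonpos_iff R hρ).1 hneg.le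
      rw [ratioIndex_of_one_le R h1.le, ratioIndex_of_one_le R h1', neg_inj, Nat.cast_inj] at h
      have hsub : (R.filter fun σ => 1 < σ ∧ σ ≤ ρ) ⊆ (R.filter fun σ => 1 < σ ∧ σ ≤ ρ') :=
        Finset.monotone_filter_right _ fun z _ hz => ⟨hz.1, hz.2.trans hlt.le⟩
      have : ρ' ∈ R.filter fun σ => 1 < σ ∧ σ ≤ ρ :=
        Finset.eq_of_subset_of_card_le hsub h.ge ▸
          Finset.mem_filter.2 ⟨hρ', h1, le_rfl⟩
      exact (Finset.mem_filter.1 this).2.2.not_gt hlt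
  intro ρ hρ ρ' hρ' h
  rcases lt_trichotomy ρ ρ' with h' | h' | h'
  · exact absurd h (key _ hρ _ hρ' h')
  · exact h'
  · exact absurd h.symm (key _ hρ' _ hρ h')

theorem ratioIndex_mem (R : Finset ℝ) (ρ : ℝ) :
    -((R.filter fun σ => 1 < σ).card : ℤ) ≤ ratioIndex R ρ ∧
      ratioIndex R ρ ≤ (R.filter fun σ => σ < 1).card := by
  have h1 : (R.filter fun σ => ρ ≤ σ ∧ σ < 1).card ≤ (R.filter fun σ => σ < 1).card :=
    Finset.card_le_card (Finset.monotone_filter_right _ fun z _ hz => hz.2)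
  have h2 : (R.filter fun σ => 1 < σ ∧ σ ≤ ρ).card ≤ (R.filter fun σ => 1 < σ).card :=
    Finset.card_le_card (Finset.monotone_filter_right _ fun z _ hz => hz.1)
  unfold ratioIndex
  omega

/-- On either side of `1`, index `±k` belongs to the `k`-th element of `R` counted outward from `1`.
The index `0` is excluded because `1` need not lie in `R`; this is why only the parts of index `0`
may be empty. -/
theorem exists_ratioIndex_eq (R : Finset ℝ) (i : ℤ)
    (ha : -((R.filter fun σ => 1 < σ).card : ℤ) ≤ i) (hb : i ≤ (R.filter fun σ => σ < 1).card)
    (hi : i ≠ 0) : ∃ ρ ∈ R, ratioIndex R ρ = i := by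
  rcases hi.lt_or_gt with h | h
  · obtain ⟨ρ, hρ, hc⟩ := exists_card_filter_rel_eq (fun x y : ℝ => y ≤ x) (R.filter fun σ => 1 < σ)
      i.natAbs (by omega) (by omega)
    have hρ' := Finset.mem_filter.1 hρ
    refine ⟨ρ, hρ'.1, ?_⟩
    rw [Finset.filter_filter] at hc
    rw [ratioIndex_of_one_le R hρ'.2.le, hc]
    omega
  · obtain ⟨ρ, hρ, hc⟩ := exists_card_filter_rel_eq (fun x y : ℝ => x ≤ y) (R.filter fun σ => σ < 1)
      i.natAbs (by omega) (by omega)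
    have hρ' := Finset.mem_filter.1 hρ
    refine ⟨ρ, hρ'.1, ?_⟩
    rw [Finset.filter_filter] at hc
    rw [ratioIndex_of_le_one R hρ'.2.le]
    simp only [and_comm] at hc ⊢
    rw [hc]
    omega

variable {U VP : Type*} [Fintype U] [Fintype VP]

/-- Each nonisolated online node can distribute one unit over its neighbours so that it only uses
neighbours of least total load. -/
theorem exists_balanced_assignment (H : VP → Finset U) :
    ∃ w : U → VP → ℝ, (∀ u v, 0 ≤ w u v) ∧ (∀ u v, u ∉ H v → w u v = 0) ∧
      (∀ v, (H v).Nonempty → ∑ u, w u v = 1) ∧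
      ∀ u v, w u v ≠ 0 → ∀ u' ∈ H v, ∑ v', w u v' ≤ ∑ v', w u' v' := by
  classical
  let C : Set (U → VP → ℝ) := {w | (∀ u v, 0 ≤ w u v) ∧ (∀ u v, u ∉ H v → w u v = 0) ∧
    ∀ v, (H v).Nonempty → ∑ u, w u v = 1}
  have hC1 : ∀ w ∈ C, ∀ u v, w u v ≤ 1 := by
    rintro w ⟨h0, hs, h1⟩ u v
    by_cases hu : u ∈ H v
    · rw [← h1 v ⟨u, hu⟩]
      exact Finset.single_le_sum (f := fun u => w u v) (fun u _ => h0 u v) (Finset.mem_univ u)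
    · rw [hs u v hu]; exact zero_le_one
  have hCclosed : IsClosed C := by
    have e : C = (⋂ u, ⋂ v, {w | 0 ≤ w u v}) ∩ ((⋂ u, ⋂ v, ⋂ (_ : u ∉ H v), {w | w u v = 0}) ∩
        ⋂ v, ⋂ (_ : (H v).Nonempty), {w | ∑ u, w u v = 1}) := by
      ext w; simp [C]
    rw [e]
    refine IsClosed.inter ?_ (IsClosed.inter ?_ ?_)
    · exact isClosed_iInter fun u => isClosed_iInter fun v =>
        isClosed_le continuous_const (by fun_prop)
    · exact isClosed_iInter fun u => isClosed_iInter fun v => isClosed_iInter fun _ =>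
        isClosed_eq (by fun_prop) continuous_const
    · exact isClosed_iInter fun v => isClosed_iInter fun _ =>
        isClosed_eq (by fun_prop) continuous_const
  have hCcompact : IsCompact C := by
    refine IsCompact.of_isClosed_subset (isCompact_univ_pi fun u : U =>
      isCompact_univ_pi fun v : VP => isCompact_Icc (a := (0 : ℝ)) (b := 1)) hCclosed ?_
    intro w hw u _ v _
    exact ⟨hw.1 u v, hC1 w hw u v⟩
  have hCne : C.Nonempty := by
    refine ⟨fun u v => if h : (H v).Nonempty then (if u = h.choose then 1 else 0) else 0,
      fun u v => ?_, fun u v hu => ?_, fun v hv => ?_⟩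
    · dsimp only; split_ifs <;> norm_num
    · dsimp only
      split_ifs with h h'
      · exact absurd (h' ▸ h.choose_spec) hu
      · rfl
      · rfl
    · simp [hv]
  -- At a minimum of the sum of squared loads, no online node can shift mass to a less loaded
  -- neighbour.
  obtain ⟨w, hw, hmin⟩ := hCcompact.exists_isMinOn hCne
    (f := fun w => ∑ u, (∑ v, w u v) ^ 2) (by fun_prop)
  refine ⟨w, hw.1, hw.2.1, hw.2.2, fun u v huv u' hu' => ?_⟩
  by_contra! hlt
  have hu : u ∈ H v := by
    by_contra h
    exact huv (hw.2.1 u v h)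
  have hne : u ≠ u' := by rintro rfl; exact lt_irrefl _ hlt
  have hpos : 0 < w u v := lt_of_le_of_ne (hw.1 u v) (Ne.symm huv)
  set q : U → ℝ := fun z => ∑ v', w z v' with hq
  -- moving a small amount from `u` to `u'` lowers the objective
  set ε : ℝ := min (w u v) ((q u - q u') / 2) with hε
  have hε0 : 0 < ε := lt_min hpos (by simp only [hq]; linarith)
  let d : U → ℝ := fun z => if z = u then -ε else if z = u' then ε else 0
  have hd : d = fun z => (if z = u then -ε else 0) + (if z = u' then ε else 0) := by
    funext z
    simp only [d]
    split_ifs with h1 h2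
    · exact absurd (h1.symm.trans h2) hne
    · simp
    · simp
    · simp
  let w' : U → VP → ℝ := fun z v' => w z v' + if v' = v then d z else 0
  have hw' : w' ∈ C := by
    refine ⟨fun z v' => ?_, fun z v' hz => ?_, fun v' hv' => ?_⟩
    · simp only [w', d]
      have := hw.1 z v'
      split_ifs with h1 h2 h3
      · subst h1 h2
        have := min_le_left (w z v') ((q z - q u') / 2)
        linarith
      · linarith
      · linarith
      · linarith
    · simp only [w', d, hw.2.1 z v' hz, zero_add]
      split_ifs with h1 h2 h3
      · subst h1 h2; exact absurd hu hz
      · subst h1 h3; exact absurd hu' hz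
      · rfl
      · rfl
    · simp only [w', Finset.sum_add_distrib, hw.2.2 v' hv']
      split_ifs
      · simp [hd, Finset.sum_add_distrib]
      · simp
  have hq' : ∀ z, ∑ v', w' z v' = q z + d z := by
    intro z
    simp [w', hq, Finset.sum_add_distrib]
  have hle := hmin hw'
  simp only [Set.mem_ofPred_eq, hq'] at hle
  have hexp : ∑ z, (q z + d z) ^ 2 = ∑ z, q z ^ 2 + (2 * ε * (q u' - q u) + 2 * ε ^ 2) := by
    have : ∀ z, (q z + d z) ^ 2 = q z ^ 2 + ((if z = u then -2 * ε * q u + ε ^ 2 else 0) +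
        (if z = u' then 2 * ε * q u' + ε ^ 2 else 0)) := by
      intro z
      simp only [d]
      split_ifs with h1 h2 h3
      · exact absurd (h1.symm.trans h2) hne
      · rw [h1]; ring
      · rw [h3]; ring
      · ring
    simp only [this, Finset.sum_add_distrib, Finset.sum_ite_eq', Finset.mem_univ, if_true]
    ring
  rw [hexp] at hle
  -- The objective changes by `-2ε(q u - q u') + 2ε²`, at most `-ε(q u - q u') < 0` for this `ε`.
  have h2 : ε ≤ (q u - q u') / 2 := min_le_right _ _
  have hlt' : q u' < q u := hlt
  nlinarith [mul_le_mul_of_nonneg_left h2 hε0.le, mul_pos hε0 (sub_pos.2 hlt')]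

end SkeletonExistence


/-! ### The skeleton decomposition from the load classes -/

section SkeletonConstruction

variable {U VP : Type*} [Fintype U] [Fintype VP]

/-- Every predicted graph has a skeleton decomposition with a balanced fractional matching. -/
theorem exists_skeleton_isBalanced (H : VP → Finset U) :
    ∃ (D : Skeleton H) (x₀ : U → VP → ℝ), D.IsBalanced x₀ := by
  classical
  obtain ⟨w, hw0, hws, hw1, hwmin⟩ := exists_balanced_assignment H
  set q : U → ℝ := fun u => ∑ v, w u v with hq
  -- The number attached to `v` is the least load among its neighbours, hence the common load of all
  -- neighbours that `v` uses.
  have hex : ∀ v, ∃ ρ : ℝ, (H v).Nonempty →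
      (∀ u ∈ H v, ρ ≤ q u) ∧ ∀ u, w u v ≠ 0 → q u = ρ := by
    intro v
    by_cases hv : (H v).Nonempty
    · obtain ⟨u₀, hu₀, hmin⟩ := (H v).exists_min_image q hv
      refine ⟨q u₀, fun _ => ⟨hmin, fun u hu => le_antisymm (hwmin u v hu u₀ hu₀) (hmin u ?_)⟩⟩
      by_contra h
      exact hu (hws u v h)
    · exact ⟨0, fun h => absurd h hv⟩
  choose r hr using hex
  have hedge : ∀ u v, u ∈ H v → r v ≤ q u := fun u v hu => (hr v ⟨u, hu⟩).1 u hu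
  have hsupp : ∀ u v, w u v ≠ 0 → u ∈ H v := by
    intro u v h
    by_contra h'
    exact h (hws u v h')
  have hused : ∀ u v, w u v ≠ 0 → q u = r v := fun u v h => (hr v ⟨u, hsupp u v h⟩).2 u h
  have hq0 : ∀ u, 0 ≤ q u := fun u => Finset.sum_nonneg fun v _ => hw0 u v
  have hpartner : ∀ v, (H v).Nonempty → ∃ u, w u v ≠ 0 := by
    intro v hv
    by_contra! h
    have := hw1 v hv
    simp [h] at this
  have hrpos : ∀ v, (H v).Nonempty → 0 < r v := by
    intro v hv
    obtain ⟨u, hu⟩ := hpartner v hv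
    rw [← hused u v hu]
    exact Finset.sum_pos' (fun v _ => hw0 u v)
      ⟨v, Finset.mem_univ _, lt_of_le_of_ne (hw0 u v) hu.symm⟩
  have hqpos : ∀ u v, u ∈ H v → 0 < q u := fun u v hu => (hrpos v ⟨u, hu⟩).trans_le (hedge u v hu)
  have hqpartner : ∀ u, 0 < q u → ∃ v, w u v ≠ 0 := by
    intro u hu
    by_contra! h
    simp [hq, h] at hu
  set W : Finset VP := Finset.univ.filter fun v => (H v).Nonempty with hW
  set X : Finset U := Finset.univ.filter fun u => 0 < q u with hX
  have memW : ∀ v, v ∈ W ↔ (H v).Nonempty := fun v => by simp [hW]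
  have memX : ∀ u, u ∈ X ↔ 0 < q u := fun u => by simp [hX]
  -- Online nodes are grouped by `r` and offline nodes by `q`. Mass flows only between equal values,
  -- so the value `ρ` of a class is its ratio `|S|/|T|`.
  set R : Finset ℝ := W.image r with hR
  have hrR : ∀ v ∈ W, r v ∈ R := fun v hv => Finset.mem_image_of_mem r hv
  have hqR : ∀ u ∈ X, q u ∈ R := by
    intro u hu
    obtain ⟨v, hv⟩ := hqpartner u ((memX u).1 hu)
    rw [hused u v hv]
    exact hrR v ((memW v).2 ⟨u, hsupp u v hv⟩)
  let S : ℤ → Finset VP := fun i => W.filter fun v => ratioIndex R (r v) = i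
  let T : ℤ → Finset U := fun i => X.filter fun u => ratioIndex R (q u) = i
  have memS : ∀ i v, v ∈ S i ↔ v ∈ W ∧ ratioIndex R (r v) = i := fun i v => Finset.mem_filter
  have memT : ∀ i u, u ∈ T i ↔ u ∈ X ∧ ratioIndex R (q u) = i := fun i u => Finset.mem_filter
  have hSr : ∀ ρ ∈ R, ∀ v, v ∈ S (ratioIndex R ρ) ↔ v ∈ W ∧ r v = ρ := fun ρ hρ v => by
    rw [memS]
    exact ⟨fun h => ⟨h.1, ratioIndex_injOn R (hrR v h.1) hρ h.2⟩, fun h => ⟨h.1, by rw [h.2]⟩⟩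
  have hTr : ∀ ρ ∈ R, ∀ u, u ∈ T (ratioIndex R ρ) ↔ u ∈ X ∧ q u = ρ := fun ρ hρ u => by
    rw [memT]
    exact ⟨fun h => ⟨h.1, ratioIndex_injOn R (hqR u h.1) hρ h.2⟩, fun h => ⟨h.1, by rw [h.2]⟩⟩
  have hsame : ∀ u v, w u v ≠ 0 → v ∈ S (ratioIndex R (q u)) ∧ u ∈ T (ratioIndex R (q u)) := by
    intro u v h
    exact ⟨(memS _ _).2 ⟨(memW v).2 ⟨u, hsupp u v h⟩, by rw [hused u v h]⟩,
      (memT _ _).2 ⟨(memX u).2 (hqpos u v (hsupp u v h)), rfl⟩⟩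
  have hRpos : ∀ ρ ∈ R, 0 < ρ := by
    intro ρ hρ
    obtain ⟨v, hv, rfl⟩ := Finset.mem_image.1 hρ
    exact hrpos v ((memW v).1 hv)
  have hSne : ∀ ρ ∈ R, (S (ratioIndex R ρ)).Nonempty := by
    intro ρ hρ
    obtain ⟨v, hv, rfl⟩ := Finset.mem_image.1 hρ
    exact ⟨v, (hSr _ hρ v).2 ⟨hv, rfl⟩⟩
  have hTne : ∀ ρ ∈ R, (T (ratioIndex R ρ)).Nonempty := by
    intro ρ hρ
    obtain ⟨v, hv, rfl⟩ := Finset.mem_image.1 hρ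
    obtain ⟨u, hu⟩ := hpartner v ((memW v).1 hv)
    exact ⟨u, hused u v hu ▸ (hsame u v hu).2⟩
  -- double counting of the assignment within one part
  have hcount : ∀ ρ ∈ R, ((S (ratioIndex R ρ)).card : ℝ) = ρ * (T (ratioIndex R ρ)).card := by
    intro ρ hρ
    have h1 : ((S (ratioIndex R ρ)).card : ℝ) = ∑ v ∈ S (ratioIndex R ρ), ∑ u, w u v := by
      rw [Finset.sum_congr rfl fun v hv => hw1 v ((memW v).1 ((memS _ v).1 hv).1)]
      simp
    have h2 : ρ * ((T (ratioIndex R ρ)).card : ℝ) = ∑ u ∈ T (ratioIndex R ρ), ∑ v, w u v := by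
      rw [Finset.sum_congr rfl fun u hu => ((hTr ρ hρ u).1 hu).2]
      simp [mul_comm]
    have h3 : ∑ v ∈ S (ratioIndex R ρ), ∑ u, w u v =
        ∑ v ∈ S (ratioIndex R ρ), ∑ u ∈ T (ratioIndex R ρ), w u v := by
      refine Finset.sum_congr rfl fun v hv => (Finset.sum_subset (Finset.subset_univ _) ?_).symm
      intro u _ hu
      by_contra h
      have hv' := ((hSr ρ hρ v).1 hv).2
      rw [← hv', ← hused u v h] at hu
      exact hu (hsame u v h).2
    have h4 : ∑ u ∈ T (ratioIndex R ρ), ∑ v, w u v =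
        ∑ u ∈ T (ratioIndex R ρ), ∑ v ∈ S (ratioIndex R ρ), w u v := by
      refine Finset.sum_congr rfl fun u hu => (Finset.sum_subset (Finset.subset_univ _) ?_).symm
      intro v _ hv
      by_contra h
      rw [← ((hTr ρ hρ u).1 hu).2] at hv
      exact hv (hsame u v h).1
    rw [h1, h2, h3, h4, Finset.sum_comm]
  have hratio : ∀ ρ ∈ R,
      ((S (ratioIndex R ρ)).card : ℝ) / (T (ratioIndex R ρ)).card = ρ := by
    intro ρ hρ
    have : ((T (ratioIndex R ρ)).card : ℝ) ≠ 0 := by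
      exact_mod_cast (Finset.card_pos.2 (hTne ρ hρ)).ne'
    rw [hcount ρ hρ, mul_div_cancel_right₀ _ this]
  have hsurj := exists_ratioIndex_eq R
  let D : Skeleton H :=
    { a := -((R.filter fun σ => 1 < σ).card : ℤ)
      b := (R.filter fun σ => σ < 1).card
      S := S
      T := T
      Sbot := Wᶜ
      Ttop := Xᶜ
      a_nonpos := by simp
      b_nonneg := by simp
      S_outside := fun i hi => Finset.filter_eq_empty_iff.2 fun v _ h => by
        have := ratioIndex_mem R (r v)
        omega
      T_outside := fun i hi => Finset.filter_eq_empty_iff.2 fun u _ h => by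
        have := ratioIndex_mem R (q u)
        omega
      S_nonempty := fun i ha hb hi => by
        obtain ⟨ρ, hρ, rfl⟩ := hsurj i ha hb hi
        exact hSne ρ hρ
      T_nonempty := fun i ha hb hi => by
        obtain ⟨ρ, hρ, rfl⟩ := hsurj i ha hb hi
        exact hTne ρ hρ
      S_disjoint := fun i j hij => Finset.disjoint_left.2 fun v h h' =>
        hij (((memS i v).1 h).2.symm.trans ((memS j v).1 h').2)
      T_disjoint := fun i j hij => Finset.disjoint_left.2 fun u h h' =>
        hij (((memT i u).1 h).2.symm.trans ((memT j u).1 h').2)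
      Sbot_disjoint := fun i => Finset.disjoint_left.2 fun v h h' =>
        Finset.mem_compl.1 h ((memS i v).1 h').1
      Ttop_disjoint := fun i => Finset.disjoint_left.2 fun u h h' =>
        Finset.mem_compl.1 h ((memT i u).1 h').1
      S_cover := fun v => by
        by_cases hv : v ∈ W
        · exact Or.inr ⟨_, (memS _ v).2 ⟨hv, rfl⟩⟩
        · exact Or.inl (Finset.mem_compl.2 hv)
      T_cover := fun u => by
        by_cases hu : u ∈ X
        · exact Or.inr ⟨_, (memT _ u).2 ⟨hu, rfl⟩⟩
        · exact Or.inl (Finset.mem_compl.2 hu)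
      Sbot_isolated := fun v hv => Finset.not_nonempty_iff_eq_empty.1 fun h =>
        Finset.mem_compl.1 hv ((memW v).2 h)
      Ttop_isolated := fun u hu v h => Finset.mem_compl.1 hu ((memX u).2 (hqpos u v h))
      neighbours := fun j u => by
        constructor
        -- Edges at `v` lead only to loads at least `r v`, and the index reverses the order.
        · rintro ⟨i, hi, v, hv, hu⟩
          refine ⟨ratioIndex R (q u), ?_, (memT _ u).2 ⟨(memX u).2 (hqpos u v hu), rfl⟩⟩
          have := ratioIndex_antitone R (hedge u v hu)
          have := ((memS i v).1 hv).2
          omega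
        · rintro ⟨i, hi, hu⟩
          obtain ⟨hu1, rfl⟩ := (memT i u).1 hu
          obtain ⟨v, hv⟩ := hqpartner u ((memX u).1 hu1)
          exact ⟨_, hi, v, (hsame u v hv).1, hsupp u v hv⟩
      card_zero := by
        by_cases h1 : (1 : ℝ) ∈ R
        · have := hcount 1 h1
          rw [ratioIndex_one, one_mul] at this
          exact_mod_cast this
        · have key : ∀ ρ ∈ R, ratioIndex R ρ ≠ 0 := fun ρ hρ h => by
            have h' := (ratioIndex_nonneg_iff R hρ).1 h.ge
            have h'' := (ratioIndex_nonpos_iff R hρ).1 h.le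
            exact h1 (le_antisymm h' h'' ▸ hρ)
          have hS0 : S 0 = ∅ := Finset.filter_eq_empty_iff.2 fun v hv => key _ (hrR v hv)
          have hT0 : T 0 = ∅ := Finset.filter_eq_empty_iff.2 fun u hu => key _ (hqR u hu)
          rw [hS0, hT0]
          rfl
      ratio_gt_one := fun i ha hi => by
        have := Nat.cast_nonneg (α := ℤ) (R.filter fun σ => σ < 1).card
        obtain ⟨ρ, hρ, rfl⟩ := hsurj i ha (by omega) hi.ne
        rw [hratio ρ hρ]
        by_contra h
        exact hi.not_ge ((ratioIndex_nonneg_iff R hρ).2 (not_lt.1 h))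
      ratio_lt_one := fun i hi hb => by
        have := Nat.cast_nonneg (α := ℤ) (R.filter fun σ => 1 < σ).card
        obtain ⟨ρ, hρ, rfl⟩ := hsurj i (by omega) hb hi.ne'
        rw [hratio ρ hρ]
        by_contra h
        exact hi.not_ge ((ratioIndex_nonpos_iff R hρ).2 (not_lt.1 h))
      ratio_strictAnti := fun i j ha hij hb hi hj => by
        obtain ⟨ρ, hρ, rfl⟩ := hsurj i ha (by omega) hi
        obtain ⟨ρ', hρ', rfl⟩ := hsurj j (by omega) hb hj
        rw [hratio ρ hρ, hratio ρ' hρ']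
        by_contra h
        exact hij.not_ge (ratioIndex_antitone R (not_lt.1 h)) }
  -- In the class of ratio `ρ` every offline load is `ρ`. This factor caps it at `1`; being constant
  -- on classes, it can be read at either endpoint of an edge carrying mass.
  let f : ℝ → ℝ := fun ρ => min 1 ρ⁻¹
  have hf0 : ∀ ρ, 0 < ρ → 0 ≤ f ρ := fun ρ h => le_min zero_le_one (inv_pos.2 h).le
  have hfge : ∀ ρ, 1 ≤ ρ → f ρ = ρ⁻¹ := fun ρ h => min_eq_right (inv_le_one_of_one_le₀ h)
  have hfle : ∀ ρ, 0 < ρ → ρ ≤ 1 → f ρ = 1 := fun ρ h h' => min_eq_left ((one_le_inv₀ h).2 h')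
  let x : U → VP → ℝ := fun u v => w u v * f (r v)
  have hxw : ∀ u v, x u v ≠ 0 → w u v ≠ 0 := fun u v h => left_ne_zero_of_mul h
  have hxu : ∀ u v, x u v = w u v * f (q u) := by
    intro u v
    by_cases h : w u v = 0
    · simp [x, h]
    · simp only [x]; rw [hused u v h]
  have hdegU : ∀ u, ∑ v, x u v = q u * f (q u) := by
    intro u
    simp only [hxu, ← Finset.sum_mul, hq]
  have hdegV : ∀ v ∈ W, ∑ u, x u v = f (r v) := by
    intro v hv
    simp only [x, ← Finset.sum_mul, hw1 v ((memW v).1 hv), one_mul]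
  have hqf : ∀ u, q u * f (q u) ≤ 1 := by
    intro u
    rcases (hq0 u).eq_or_lt with h | h
    · rw [← h]; simp
    · calc q u * f (q u) ≤ q u * (q u)⁻¹ := mul_le_mul_of_nonneg_left (min_le_right _ _) h.le
        _ = 1 := mul_inv_cancel₀ h.ne'
  refine ⟨D, x, ⟨fun u v => ?_, fun u v hu => ?_, fun u => ?_, fun v => ?_⟩, ?_, ?_, ?_, ?_, ?_⟩
  · by_cases h : w u v = 0
    · simp [x, h]
    · exact mul_nonneg (hw0 u v) (hf0 _ (hrpos v ⟨u, hsupp u v h⟩))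
  · simp [x, hws u v hu]
  · rw [hdegU]; exact hqf u
  · by_cases hv : v ∈ W
    · rw [hdegV v hv]; exact min_le_left _ _
    · have : ∀ u, x u v = 0 := fun u => by
        simp [x, hws u v fun h => hv ((memW v).2 ⟨u, h⟩)]
      simp [this]
  · intro i hi v hv
    obtain ⟨hvW, rfl⟩ := (memS i v).1 hv
    rw [hdegV v hvW]
    exact hfle _ (hRpos _ (hrR v hvW)) ((ratioIndex_nonneg_iff R (hrR v hvW)).1 hi)
  · intro i hi u hu
    obtain ⟨huX, rfl⟩ := (memT i u).1 hu
    have := hqR u huX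
    change _ = ((S (ratioIndex R (q u))).card : ℝ) / (T (ratioIndex R (q u))).card
    rw [hdegU, hratio _ this,
      hfle _ (hRpos _ this) ((ratioIndex_nonneg_iff R this).1 hi), mul_one]
  · intro i hi u hu
    obtain ⟨huX, rfl⟩ := (memT i u).1 hu
    have := hqR u huX
    rw [hdegU, hfge _ ((ratioIndex_nonpos_iff R this).1 hi.le),
      mul_inv_cancel₀ (hRpos _ this).ne']
  · intro i hi v hv
    obtain ⟨hvW, rfl⟩ := (memS i v).1 hv
    have := hrR v hvW
    change _ = ((T (ratioIndex R (r v))).card : ℝ) / (S (ratioIndex R (r v))).card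
    rw [hdegV v hvW, hfge _ ((ratioIndex_nonpos_iff R this).1 hi.le), ← inv_div, hratio _ this]
  · intro u v h
    exact ⟨_, (hsame u v (hxw u v h)).2, (hsame u v (hxw u v h)).1⟩

end SkeletonConstruction


/-! ### The analytic bound on the total level -/

section LevelInequality

open Set

/-- The right derivative of `t ↦ min y t`. -/
theorem hasDerivWithinAt_min_right (y t : ℝ) :
    HasDerivWithinAt (fun s => min y s) (if t < y then 1 else 0) (Ici t) t := by
  split_ifs with h
  · refine (hasDerivWithinAt_id t (Ici t)).congr_of_eventuallyEq ?_ (by simp [h.le])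
    filter_upwards [mem_nhdsWithin_of_mem_nhds (Iio_mem_nhds h)] with s hs
    exact min_eq_right (le_of_lt hs)
  · refine (hasDerivWithinAt_const t (Ici t) y).congr ?_ (by simp [not_lt.1 h])
    intro s hs
    exact min_eq_left ((not_lt.1 h).trans hs)

/-- The tangent bound for the convex function `y ↦ (y - 1) e ^ y` on the nonnegative reals. -/
theorem sub_one_mul_exp_tangent {c y : ℝ} (hc : 0 ≤ c) (hy : 0 ≤ y) :
    (c - 1) * Real.exp c + c * Real.exp c * (y - c) ≤ (y - 1) * Real.exp y := by
  have hder : ∀ x, HasDerivAt (fun y : ℝ => (y - 1) * Real.exp y) (x * Real.exp x) x := by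
    intro x
    refine (((hasDerivAt_id x).sub_const 1).mul (Real.hasDerivAt_exp x)).congr_deriv ?_
    simp only [id]
    ring
  have hconv : ConvexOn ℝ (Ici 0) (fun y : ℝ => (y - 1) * Real.exp y) := by
    refine MonotoneOn.convexOn_of_deriv (convex_Ici 0)
      (fun x _ => (hder x).continuousAt.continuousWithinAt)
      (fun x _ => (hder x).differentiableAt.differentiableWithinAt) ?_
    intro x hx z hz hxz
    rw [interior_Ici] at hx hz
    rw [(hder x).deriv, (hder z).deriv]
    exact mul_le_mul hxz (Real.exp_le_exp.2 hxz) (Real.exp_pos _).le (le_of_lt hz)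
  rcases lt_trichotomy c y with h | rfl | h
  · have := hconv.le_slope_of_hasDerivAt (mem_Ici.2 hc) (mem_Ici.2 hy) h (hder c)
    rw [slope_def_field, le_div_iff₀ (by linarith)] at this
    linarith
  · simp
  · have := hconv.slope_le_of_hasDerivAt (mem_Ici.2 hy) (mem_Ici.2 hc) h (hder c)
    rw [slope_def_field, div_le_iff₀ (by linarith)] at this
    linarith

variable {U : Type*} [Fintype U]

/-- The tangent from the point `(1, n)` to the concave function `t ↦ ∑ u, min (y u) t`. -/
theorem exists_tangent (n : ℝ) (y : U → ℝ) (hn : 0 < n) (hy0 : ∀ u, 0 ≤ y u) (hy1 : ∀ u, y u ≤ 1)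
    (hlt : ∑ u, y u < n) :
    ∃ τ γ : ℝ, 0 ≤ τ ∧ τ < 1 ∧ 0 < γ ∧ γ ≤ n ∧ ∑ u, min (y u) τ = n - γ * (1 - τ) ∧
      ((Finset.univ.filter fun u => τ < y u).card : ℝ) ≤ γ := by
  classical
  set G : ℝ → ℝ := fun t => ∑ u, min (y u) t with hG
  have hGle : ∀ t, G t ≤ ∑ u, y u := fun t => Finset.sum_le_sum fun u _ => min_le_left _ _
  have hGc : Continuous G := by fun_prop
  have hG0 : G 0 = 0 := Finset.sum_eq_zero fun u _ => min_eq_right (hy0 u)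
  set s := ∑ u, y u with hs
  have hs0 : 0 ≤ s := Finset.sum_nonneg fun u _ => hy0 u
  set t₁ : ℝ := s / n with ht₁
  have ht₁0 : 0 ≤ t₁ := div_nonneg hs0 hn.le
  -- The minimum of the slope `(n - G t) / (1 - t)` may be sought on `[0, t₁]`, away from the pole
  -- at `1`: beyond `t₁` already the line of slope `n` through `(1, n)` lies above `s`, which bounds
  -- `G`.
  have ht₁1 : t₁ < 1 := (div_lt_one hn).2 hlt
  have hcont : ContinuousOn (fun t => (n - G t) / (1 - t)) (Icc 0 t₁) := by
    refine ContinuousOn.div (by fun_prop) (by fun_prop) fun t ht => ?_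
    have := ht.2
    linarith
  obtain ⟨τ, hτ, hmin⟩ := isCompact_Icc.exists_isMinOn ⟨0, left_mem_Icc.2 ht₁0⟩ hcont
  have hτ1 : 0 < 1 - τ := by have := hτ.2; linarith
  set γ := (n - G τ) / (1 - τ) with hγ
  have hγn : γ ≤ n := by
    have := hmin (left_mem_Icc.2 ht₁0)
    simp only [mem_ofPred_eq, hG0] at this
    simpa using this
  have hγτ : γ * (1 - τ) = n - G τ := div_mul_cancel₀ _ hτ1.ne'
  have hγ0 : 0 < γ := div_pos (by linarith [hGle τ]) hτ1
  have hline : ∀ t, 0 ≤ t → t ≤ 1 → γ * (1 - t) ≤ n - G t := by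
    intro t h0 h1
    rcases le_or_gt t t₁ with h | h
    · have := hmin (⟨h0, h⟩ : t ∈ Icc 0 t₁)
      simp only [mem_ofPred_eq] at this
      rwa [← hγ, le_div_iff₀ (by linarith)] at this
    · have h2 : n * (1 - t) ≤ n * (1 - t₁) := mul_le_mul_of_nonneg_left (by linarith) hn.le
      have h3 : n * (1 - t₁) = n - s := by rw [ht₁]; field_simp
      have h4 : γ * (1 - t) ≤ n * (1 - t) := mul_le_mul_of_nonneg_right hγn (by linarith)
      linarith [hGle t]
  refine ⟨τ, γ, hτ.1, by linarith, hγ0, hγn, by linarith, ?_⟩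
  set F := Finset.univ.filter fun u => τ < y u with hF
  rcases F.eq_empty_or_nonempty with h | h
  · rw [h]; simpa using hγ0.le
  obtain ⟨u₀, hu₀, hu₀min⟩ := F.exists_min_image y h
  have hu₀τ : τ < y u₀ := (Finset.mem_filter.1 hu₀).2
  -- Up to the next level `y u₀`, `G` grows at rate at least `#F`; a rate above `γ` would push it
  -- over the supporting line.
  have hdiff : (F.card : ℝ) * (y u₀ - τ) ≤ G (y u₀) - G τ := by
    rw [hG, ← Finset.sum_sub_distrib, ← nsmul_eq_mul, ← Finset.sum_const, hF, Finset.sum_filter]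
    refine Finset.sum_le_sum fun u _ => ?_
    split_ifs with hu
    · rw [min_eq_right hu.le, min_eq_right (hu₀min u (by simpa [hF] using hu))]
    · exact sub_nonneg.2 (min_le_min_left _ hu₀τ.le)
  have hl := hline (y u₀) (hy0 _) (hy1 _)
  have : (F.card : ℝ) * (y u₀ - τ) ≤ γ * (y u₀ - τ) := by nlinarith
  exact le_of_mul_le_mul_right this (by linarith)

/-- If, at every height `t < 1`, the levels `y ≥ y₀` satisfy the covering inequality `hcov`,
then the total level is large. -/
theorem le_sum_levels (n : ℝ) (y₀ y : U → ℝ) (hn : 0 < n) (h0 : ∀ u, 0 ≤ y₀ u)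
    (hle : ∀ u, y₀ u ≤ y u) (h1 : ∀ u, y u ≤ 1) (hsn : ∑ u, y₀ u ≤ n)
    (hcov : ∀ t, 0 ≤ t → t < 1 →
      n ≤ ((Finset.univ.filter fun u => t < y u).card : ℝ) + ∑ u, min (y u) t
        - t * ((Finset.univ.filter fun u => t < y₀ u).card : ℝ)) :
    n - (n - ∑ u, y₀ u) * Real.exp (-(1 - (∑ u, y₀ u) / n)) ≤ ∑ u, y u := by
  classical
  set s := ∑ u, y₀ u with hs
  have hsy : s ≤ ∑ u, y u := Finset.sum_le_sum fun u _ => hle u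
  rcases hsn.eq_or_lt with hsn | hsn
  · rw [hsn]; simpa using hsn ▸ hsy
  obtain ⟨τ, γ, hτ0, hτ1, hγ0, hγn, hGτ, hcard⟩ :=
    exists_tangent n y₀ hn h0 (fun u => (hle u).trans (h1 u)) hsn
  -- integrate the covering inequality against `exp` over `[τ, 1]`
  have hmono := image_le_of_deriv_right_le_deriv_boundary (a := τ) (b := 1)
    (f := fun t => (∑ u, (min (y₀ u) t - 1) * Real.exp (min (y₀ u) t)) + n * Real.exp t
      -- This constant makes the two compared functions agree at `τ`.
      + (Real.exp τ * ((∑ u, min (y u) τ) - n)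
        - ∑ u, (min (y₀ u) τ - 1) * Real.exp (min (y₀ u) τ)))
    (f' := fun t => (∑ u, if t < y₀ u then t * Real.exp t else 0) + n * Real.exp t)
    (B := fun t => (∑ u, min (y u) t) * Real.exp t)
    (B' := fun t => (∑ u, if t < y u then (1 : ℝ) else 0) * Real.exp t
      + (∑ u, min (y u) t) * Real.exp t)
    (by fun_prop) ?_ (by linarith) (by fun_prop) ?_ ?_
    (right_mem_Icc.2 hτ1.le)
  rotate_left
  · intro t _
    refine HasDerivWithinAt.add_const _ (HasDerivWithinAt.add (HasDerivWithinAt.fun_sum fun u _ => ?_)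
      ((Real.hasDerivAt_exp t).hasDerivWithinAt.const_mul n))
    have hm := hasDerivWithinAt_min_right (y₀ u) t
    refine ((hm.sub_const 1).mul hm.exp).congr_deriv ?_
    split_ifs with h
    · rw [min_eq_right h.le]; ring
    · simp
  · intro t _
    exact HasDerivWithinAt.mul
      (HasDerivWithinAt.fun_sum fun u _ => hasDerivWithinAt_min_right (y u) t)
      (Real.hasDerivAt_exp t).hasDerivWithinAt
  · intro t ht
    have h := hcov t (hτ0.trans ht.1) ht.2
    have hsum : ∀ z : U → ℝ, ∀ k : ℝ, (∑ u, if t < z u then k else 0)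
        = k * ((Finset.univ.filter fun u => t < z u).card : ℝ) := by
      intro z k
      rw [← Finset.sum_filter, Finset.sum_const, nsmul_eq_mul, mul_comm]
    rw [hsum, hsum]
    have := mul_le_mul_of_nonneg_right h (Real.exp_pos t).le
    linarith
  -- evaluate at `1` and bound the contribution of the initial levels by convexity
  set c : ℝ := 1 - (n - s) / γ with hc
  -- `c` is the height at which the tangent line `n - γ(1 - t)` takes the value `s`.
  have hcγ : γ * (1 - c) = n - s := by rw [hc]; field_simp; ring
  have hτc : τ ≤ c := by
    have hle' : ∑ u, min (y₀ u) τ ≤ s := Finset.sum_le_sum fun u _ => min_le_left _ _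
    have : γ * (1 - c) ≤ γ * (1 - τ) := by linarith
    linarith [le_of_mul_le_mul_left this hγ0]
  have hc0 : 0 ≤ c := hτ0.trans hτc
  set k : ℝ := ((Finset.univ.filter fun u => τ < y₀ u).card : ℝ) with hk
  -- The tangent at `c` is applied to each node of initial level above `τ`; the other nodes cancel.
  have hKsum : k * ((c - 1) * Real.exp c + c * Real.exp c * (τ - c) - (τ - 1) * Real.exp τ)
      + c * Real.exp c * (s - ∑ u, min (y₀ u) τ) ≤
      (∑ u, (min (y₀ u) 1 - 1) * Real.exp (min (y₀ u) 1))
        - ∑ u, (min (y₀ u) τ - 1) * Real.exp (min (y₀ u) τ) := by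
    rw [hk, mul_comm, ← nsmul_eq_mul', ← Finset.sum_const, Finset.sum_filter, hs,
      ← Finset.sum_sub_distrib, Finset.mul_sum, ← Finset.sum_add_distrib,
      ← Finset.sum_sub_distrib]
    refine Finset.sum_le_sum fun u _ => ?_
    rw [min_eq_left ((hle u).trans (h1 u))]
    split_ifs with h
    · rw [min_eq_right h.le]
      have := sub_one_mul_exp_tangent hc0 (h0 u)
      linarith
    · rw [min_eq_left (not_lt.1 h)]; simp
  have htan := sub_one_mul_exp_tangent hc0 hτ0
  -- The bracket is nonpositive by `htan`, so the count `k ≤ γ` may be replaced by `γ`. The outcome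
  -- is as if `γ` nodes all had initial level `c`.
  have hkγ : γ * ((c - 1) * Real.exp c + c * Real.exp c * (τ - c) - (τ - 1) * Real.exp τ) ≤
      k * ((c - 1) * Real.exp c + c * Real.exp c * (τ - c) - (τ - 1) * Real.exp τ) :=
    mul_le_mul_of_nonpos_right hcard (by linarith)
  have hyτ : n - γ * (1 - τ) ≤ ∑ u, min (y u) τ :=
    hGτ ▸ Finset.sum_le_sum fun u _ => min_le_min_right _ (hle u)
  have hy1 : ∑ u, min (y u) 1 = ∑ u, y u := Finset.sum_congr rfl fun u _ => min_eq_left (h1 u)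
  simp only [hy1] at hmono
  have hexpτ := mul_le_mul_of_nonneg_left hyτ (Real.exp_pos τ).le
  have hcτ : s - ∑ u, min (y₀ u) τ = γ * (c - τ) := by rw [hGτ]; linarith
  rw [hcτ] at hKsum
  have hfin : n * Real.exp 1 - (n - s) * Real.exp c ≤ (∑ u, y u) * Real.exp 1 := by
    rw [← hcγ]; linarith
  have hexp : Real.exp c = Real.exp (c - 1) * Real.exp 1 := by rw [← Real.exp_add]; ring_nf
  have hfin' : n - (n - s) * Real.exp (c - 1) ≤ ∑ u, y u := by
    refine le_of_mul_le_mul_right ?_ (Real.exp_pos 1)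
    rw [hexp] at hfin
    linarith
  refine le_trans ?_ hfin'
  have : c - 1 ≤ -(1 - s / n) := by
    have h2 : (n - s) / n ≤ (n - s) / γ := div_le_div_of_nonneg_left (by linarith) hγ0 hγn
    have h3 : (n - s) / n = 1 - s / n := by field_simp
    linarith
  have := mul_le_mul_of_nonneg_left (Real.exp_le_exp.2 this) (by linarith : 0 ≤ n - s)
  linarith

end LevelInequality


/-! ### Properties of balanced matchings -/

section InitialLevels

variable {U VP : Type*} {H : VP → Finset U}

theorem Skeleton.exists_mem_T_le (D : Skeleton H) {u : U} {v : VP} {j : ℤ} (hv : v ∈ D.S j)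
    (hu : u ∈ H v) : ∃ i, i ≤ j ∧ u ∈ D.T i := by
  obtain ⟨i, hi, h⟩ := (D.neighbours (j + 1) u).1 ⟨j, by omega, v, hv, hu⟩
  exact ⟨i, by omega, h⟩

theorem Skeleton.exists_mem_S (D : Skeleton H) {u : U} {v : VP} (hu : u ∈ H v) :
    ∃ j, v ∈ D.S j := by
  rcases D.S_cover v with h | h
  · rw [D.Sbot_isolated v h] at hu
    simp at hu
  · exact h

variable [Fintype U] [Fintype VP] {D : Skeleton H} {x₀ : U → VP → ℝ}

/-- A predicted node with a neighbour of level below `1` is fully matched, and only to nodes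
whose level is at most that of this neighbour. -/
theorem Skeleton.IsBalanced.of_degree_lt_one (hx : D.IsBalanced x₀) {u : U} {v : VP}
    (hu : u ∈ H v) (hlt : ∑ p, x₀ u p < 1) :
    ∑ u', x₀ u' v = 1 ∧ ∀ u', x₀ u' v ≠ 0 → ∑ p, x₀ u' p ≤ ∑ p, x₀ u p := by
  obtain ⟨j, hj⟩ := D.exists_mem_S hu
  obtain ⟨i, hij, hi⟩ := D.exists_mem_T_le hj hu
  have hi0 : 0 < i := by
    rcases lt_trichotomy i 0 with h | rfl | h
    · exact absurd (hx.degree_T_of_neg i h u hi) hlt.ne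
    -- For an empty part the quotient would be `0 / 0 = 0` rather than the conventional `1`; here
    -- `u` itself witnesses that the part is nonempty.
    · have hne : ((D.T 0).card : ℝ) ≠ 0 := by
        exact_mod_cast (Finset.card_pos.2 ⟨u, hi⟩).ne'
      have := hx.degree_T_of_nonneg 0 le_rfl u hi
      rw [D.card_zero, div_self hne] at this
      exact absurd this hlt.ne
    · exact h
  have hjb : j ≤ D.b := by
    by_contra h
    have := D.S_outside j (Or.inr (not_le.1 h))
    simp [this] at hj
  refine ⟨hx.degree_S_of_nonneg j (hi0.le.trans hij) v hj, fun u' hu' => ?_⟩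
  obtain ⟨k, hk, hvk⟩ := hx.within_parts u' v hu'
  have hkj : k = j := by
    by_contra h
    exact Finset.disjoint_left.1 (D.S_disjoint k j h) hvk hj
  subst hkj
  rw [hx.degree_T_of_nonneg k (hi0.le.trans hij) u' hk, hx.degree_T_of_nonneg i hi0.le u hi]
  rcases hij.eq_or_lt with rfl | h
  · exact le_rfl
  · exact (D.ratio_strictAnti i k (by have := D.a_nonpos; omega) h hjb hi0.ne'
      (hi0.trans h).ne').le

/-- A balanced fractional matching is maximum. -/
theorem Skeleton.IsBalanced.value_eq_matchingNumber (hx : D.IsBalanced x₀) :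
    value x₀ = matchingNumber H := by
  classical
  refine le_antisymm hx.isFractionalMatching.value_le_matchingNumber ?_
  -- `A` and `B` form a cover all of whose nodes are saturated by `x₀`. No mass joins `A` to `B`, so
  -- the size of the cover is at most the value of `x₀`.
  set A : Finset U := Finset.univ.filter fun u => ∃ i, i < 0 ∧ u ∈ D.T i with hA
  set B : Finset VP := Finset.univ.filter fun v => ∃ i, 0 ≤ i ∧ v ∈ D.S i with hB
  have hcov : ∀ v, ∀ u ∈ H v, u ∈ A ∨ v ∈ B := by
    intro v u hu
    obtain ⟨j, hj⟩ := D.exists_mem_S hu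
    rcases le_or_gt 0 j with h | h
    · exact Or.inr (Finset.mem_filter.2 ⟨Finset.mem_univ _, j, h, hj⟩)
    · obtain ⟨i, hij, hi⟩ := D.exists_mem_T_le hj hu
      exact Or.inl (Finset.mem_filter.2 ⟨Finset.mem_univ _, i, by omega, hi⟩)
  have hcard : (matchingNumber H : ℝ) ≤ A.card + B.card := by
    exact_mod_cast matchingNumber_le_cover H A B hcov
  have h1 : (A.card : ℝ) = ∑ u, ∑ v, if u ∈ A then x₀ u v else 0 := by
    have : ∀ u, (∑ v, if u ∈ A then x₀ u v else 0) = if u ∈ A then 1 else 0 := by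
      intro u
      split_ifs with h
      · obtain ⟨-, i, hi, hu⟩ := Finset.mem_filter.1 h
        exact hx.degree_T_of_neg i hi u hu
      · simp
    simp [this]
  have h2 : (B.card : ℝ) = ∑ u, ∑ v, if v ∈ B then x₀ u v else 0 := by
    rw [Finset.sum_comm]
    have : ∀ v, (∑ u, if v ∈ B then x₀ u v else 0) = if v ∈ B then 1 else 0 := by
      intro v
      split_ifs with h
      · obtain ⟨-, i, hi, hv⟩ := Finset.mem_filter.1 h
        exact hx.degree_S_of_nonneg i hi v hv
      · simp
    simp [this]
  refine hcard.trans ?_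
  rw [h1, h2, ← Finset.sum_add_distrib]
  refine Finset.sum_le_sum fun u _ => ?_
  rw [← Finset.sum_add_distrib]
  refine Finset.sum_le_sum fun v _ => ?_
  have h0 := hx.isFractionalMatching.nonneg u v
  split_ifs with hu hv hv
  · have : x₀ u v = 0 := by
      by_contra h
      obtain ⟨k, hk, hvk⟩ := hx.within_parts u v h
      obtain ⟨-, i, hi, hui⟩ := Finset.mem_filter.1 hu
      obtain ⟨-, j, hj, hvj⟩ := Finset.mem_filter.1 hv
      have hik : i = k := by
        by_contra h
        exact Finset.disjoint_left.1 (D.T_disjoint i k h) hui hk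
      have hjk : j = k := by
        by_contra h
        exact Finset.disjoint_left.1 (D.S_disjoint j k h) hvj hvk
      omega
    simp [this]
  · simp
  · simp
  · simpa using h0

end InitialLevels

/-! ### A single water-filling step -/

section WaterFilling

variable {U : Type*} {N : Finset U} {y : U → ℝ}

theorem waterLevel_mem (hy : ∀ u, 0 ≤ y u) :
    0 ≤ waterLevel N y ∧ waterLevel N y ≤ 1 ∧ ∑ u ∈ N, max 0 (waterLevel N y - y u) ≤ 1 := by
  have hclosed : IsClosed {z : ℝ | 0 ≤ z ∧ z ≤ 1 ∧ ∑ u ∈ N, max 0 (z - y u) ≤ 1} := by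
    refine (isClosed_le continuous_const continuous_id).inter
      ((isClosed_le continuous_id continuous_const).inter ?_)
    exact isClosed_le (f := fun z => ∑ u ∈ N, max 0 (z - y u)) (by fun_prop) continuous_const
  refine hclosed.csSup_mem ⟨0, le_rfl, zero_le_one, ?_⟩ ⟨1, fun z hz => hz.2.1⟩
  rw [Finset.sum_eq_zero fun u _ => max_eq_left (by linarith [hy u])]
  exact zero_le_one

/-- If the water level stays below `1`, the whole unit has been poured. -/
theorem sum_max_waterLevel_eq_one (hy : ∀ u, 0 ≤ y u) (h : waterLevel N y < 1) :
    ∑ u ∈ N, max 0 (waterLevel N y - y u) = 1 := by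
  obtain ⟨hz0, -, hz1⟩ := waterLevel_mem (N := N) hy
  refine hz1.antisymm ?_
  by_contra! hlt
  set z := waterLevel N y with hz
  have hcont : Continuous fun z => ∑ u ∈ N, max 0 (z - y u) := by fun_prop
  -- If less than a unit were poured, continuity would allow a slightly higher water level.
  have hev : ∀ᶠ z' in nhdsWithin z (Set.Ioi z), ∑ u ∈ N, max 0 (z' - y u) < 1 ∧ z' < 1 ∧ z < z' := by
    filter_upwards [mem_nhdsWithin_of_mem_nhds (hcont.continuousAt.eventually_lt_const hlt),
      mem_nhdsWithin_of_mem_nhds (Iio_mem_nhds h), self_mem_nhdsWithin] with z' h1 h2 h3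
    exact ⟨h1, h2, h3⟩
  obtain ⟨z', h1, h2, h3⟩ := hev.exists
  have : z' ≤ z := le_csSup (s := {z : ℝ | 0 ≤ z ∧ z ≤ 1 ∧ ∑ u ∈ N, max 0 (z - y u) ≤ 1})
    ⟨1, fun z hz => hz.2.1⟩ ⟨by linarith, h2.le, h1.le⟩
  exact absurd h3 (not_lt.2 this)

variable [DecidableEq U]

theorem waterFill_nonneg (N : Finset U) (y : U → ℝ) (u : U) : 0 ≤ waterFill N y u := by
  unfold waterFill
  split_ifs
  · exact le_max_left _ _
  · exact le_rfl

theorem waterFill_of_notMem {u : U} (h : u ∉ N) : waterFill N y u = 0 := if_neg h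

theorem add_waterFill_le_one (hy : ∀ u, 0 ≤ y u) (hy1 : ∀ u, y u ≤ 1) (u : U) :
    y u + waterFill N y u ≤ 1 := by
  have hz := (waterLevel_mem (N := N) hy).2.1
  have := hy1 u
  unfold waterFill
  split_ifs
  · rcases max_choice 0 (waterLevel N y - y u) with h | h <;> rw [h] <;> linarith
  · linarith

theorem sum_waterFill [Fintype U] (N : Finset U) (y : U → ℝ) :
    ∑ u, waterFill N y u = ∑ u ∈ N, max 0 (waterLevel N y - y u) := by
  simp [waterFill, Finset.sum_ite_mem]

theorem waterLevel_le_add_waterFill {u : U} (hu : u ∈ N) :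
    waterLevel N y ≤ y u + waterFill N y u := by
  rw [waterFill, if_pos hu]
  linarith [le_max_right 0 (waterLevel N y - y u)]

/-- Together with `waterLevel_le_add_waterFill`, this says that a node receiving water ends no
higher than any neighbour of the online node. -/
theorem add_waterFill_le_waterLevel {u : U} (hu : waterFill N y u ≠ 0) :
    y u + waterFill N y u ≤ waterLevel N y := by
  unfold waterFill at hu ⊢
  split_ifs at hu ⊢
  · rcases max_choice 0 (waterLevel N y - y u) with h | h
    · exact absurd h hu
    · rw [h]; linarith
  · exact absurd rfl hu

end WaterFilling

/-! ### Evolution of the levels -/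

section Levels

variable {U VP VA : Type*} [DecidableEq U] [Fintype VP]

/-- The levels after the arrivals `l`. -/
noncomputable def levels (x₀ : U → VP → ℝ) (K : VA → Finset U) (l : List (VP ⊕ VA)) : U → ℝ :=
  (l.map (reveal K)).foldl levelStep fun u => ∑ p, x₀ u p

variable {x₀ : U → VP → ℝ} {K : VA → Finset U}

theorem levels_nil : levels x₀ K [] = fun u => ∑ p, x₀ u p := rfl

theorem levels_concat_inl (l : List (VP ⊕ VA)) (p : VP) :
    levels x₀ K (l ++ [Sum.inl p]) = levels x₀ K l := by
  simp [levels, reveal, levelStep]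

theorem levels_concat_inr (l : List (VP ⊕ VA)) (a : VA) :
    levels x₀ K (l ++ [Sum.inr a]) =
      fun u => levels x₀ K l u + waterFill (K a) (levels x₀ K l) u := by
  simp [levels, reveal, levelStep]

theorem le_levels (l : List (VP ⊕ VA)) (u : U) : ∑ p, x₀ u p ≤ levels x₀ K l u := by
  induction l using List.reverseRecOn with
  | nil => exact le_rfl
  | append_singleton l v ih =>
    rcases v with p | a
    · rwa [levels_concat_inl]
    · rw [levels_concat_inr]
      linarith [waterFill_nonneg (K a) (levels x₀ K l) u]

theorem levels_le_concat (l : List (VP ⊕ VA)) (v : VP ⊕ VA) (u : U) :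
    levels x₀ K l u ≤ levels x₀ K (l ++ [v]) u := by
  rcases v with p | a
  · rw [levels_concat_inl]
  · rw [levels_concat_inr]
    linarith [waterFill_nonneg (K a) (levels x₀ K l) u]

theorem levels_nonneg (h0 : ∀ u p, 0 ≤ x₀ u p) (l : List (VP ⊕ VA)) (u : U) :
    0 ≤ levels x₀ K l u :=
  (Finset.sum_nonneg fun p _ => h0 u p).trans (le_levels l u)

theorem levels_le_one (h0 : ∀ u p, 0 ≤ x₀ u p) (h1 : ∀ u, ∑ p, x₀ u p ≤ 1)
    (l : List (VP ⊕ VA)) (u : U) : levels x₀ K l u ≤ 1 := by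
  induction l using List.reverseRecOn generalizing u with
  | nil => exact h1 u
  | append_singleton l v ih =>
    rcases v with p | a
    · rw [levels_concat_inl]; exact ih u
    · rw [levels_concat_inr]
      exact add_waterFill_le_one (levels_nonneg h0 l) ih u

end Levels

/-! ### The assignment produced by the online run -/

section Run

variable {U VP VA : Type*} [DecidableEq VP] [DecidableEq VA]

/-- Decisions are irrevocable: values at `v` depend only on the arrivals up to `v`. This permits
induction on the last arrival. -/
theorem run_append_of_mem (π : OnlineRule U VP) (K : VA → Finset U) {l : List (VP ⊕ VA)}
    (l' : List (VP ⊕ VA)) {v : VP ⊕ VA} (hv : v ∈ l) (u : U) :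
    run π K (l ++ l') u v = run π K l u v := by
  unfold run
  rw [List.takeWhile_append, if_neg]
  intro h
  have := List.takeWhile_eq_self_iff.1
    ((List.takeWhile_prefix (l := l) (fun w => decide (w ≠ v))).eq_of_length h) v hv
  simp at this

theorem run_concat_self (π : OnlineRule U VP) (K : VA → Finset U) {l : List (VP ⊕ VA)}
    {v : VP ⊕ VA} (hv : v ∉ l) (u : U) :
    run π K (l ++ [v]) u v = π (l.map (reveal K)) (reveal K v) u := by
  unfold run
  have : l.takeWhile (fun w => decide (w ≠ v)) = l := by
    refine List.takeWhile_eq_self_iff.2 fun w hw => ?_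
    simp only [decide_eq_true_eq]
    rintro rfl
    exact hv hw
  rw [List.takeWhile_append, if_pos (by rw [this])]
  simp

variable [DecidableEq U] [Fintype VP] {x₀ : U → VP → ℝ} {K : VA → Finset U}

theorem run_alg_inl (l : List (VP ⊕ VA)) (u : U) (p : VP) :
    run (alg x₀) K l u (Sum.inl p) = x₀ u p := rfl

theorem run_alg_concat_inr {l : List (VP ⊕ VA)} {a : VA} (ha : Sum.inr a ∉ l) (u : U) :
    run (alg x₀) K (l ++ [Sum.inr a]) u (Sum.inr a) = waterFill (K a) (levels x₀ K l) u :=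
  run_concat_self _ K ha u

open scoped Classical in
/-- The levels record the amounts assigned so far. -/
theorem levels_eq_sum [Fintype VA] {l : List (VP ⊕ VA)} (hl : l.Nodup) (u : U) :
    levels x₀ K l u = ∑ p, x₀ u p +
      ∑ a : VA, if Sum.inr a ∈ l then run (alg x₀) K l u (Sum.inr a) else 0 := by
  induction l using List.reverseRecOn with
  | nil => simp [levels_nil]
  | append_singleton l v ih =>
    obtain ⟨hl', -, hd⟩ := List.nodup_append.1 hl
    have hv : v ∉ l := fun h => hd v h v (by simp) rfl
    rcases v with p | a
    · rw [levels_concat_inl, ih hl']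
      congr 1
      refine Finset.sum_congr rfl fun b _ => ?_
      by_cases hb : Sum.inr b ∈ l
      · simp [hb, run_append_of_mem]
      · simp [hb]
    · simp only [levels_concat_inr]
      rw [ih hl', add_assoc]
      congr 1
      have : waterFill (K a) (levels x₀ K l) u =
          ∑ b, if b = a then waterFill (K a) (levels x₀ K l) u else 0 := by simp
      rw [this, ← Finset.sum_add_distrib]
      refine Finset.sum_congr rfl fun b _ => ?_
      by_cases hba : b = a
      · subst hba
        simp [hv, run_alg_concat_inr hv]
      · by_cases hb : Sum.inr b ∈ l
        · simp [hb, hba, run_append_of_mem]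
        · simp [hb, hba]

/-- Each adversarial node is processed by water-filling at levels below the final ones. -/
theorem exists_run_eq_waterFill {l : List (VP ⊕ VA)} (hl : l.Nodup) {a : VA}
    (ha : Sum.inr a ∈ l) : ∃ l' : List (VP ⊕ VA),
      (∀ u, run (alg x₀) K l u (Sum.inr a) = waterFill (K a) (levels x₀ K l') u) ∧
      ∀ u, levels x₀ K l' u + waterFill (K a) (levels x₀ K l') u ≤ levels x₀ K l u := by
  induction l using List.reverseRecOn with
  | nil => simp at ha
  | append_singleton l v ih =>
    obtain ⟨hl', -, hd⟩ := List.nodup_append.1 hl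
    have hv : v ∉ l := fun h => hd v h v (by simp) rfl
    by_cases hal : Sum.inr a ∈ l
    · obtain ⟨l', h1, h2⟩ := ih hl' hal
      exact ⟨l', fun u => by rw [run_append_of_mem _ K _ hal, h1],
        fun u => (h2 u).trans (levels_le_concat l v u)⟩
    · have : v = Sum.inr a := by simpa [hal, eq_comm] using ha
      subst this
      exact ⟨l, fun u => run_alg_concat_inr hv u, fun u => by rw [levels_concat_inr]⟩

/-- An adversarial node with a neighbour of final level below `1` is fully matched. -/
theorem sum_run_eq_one [Fintype U] (h0 : ∀ u p, 0 ≤ x₀ u p) {l : List (VP ⊕ VA)} (hl : l.Nodup)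
    {a : VA} (ha : Sum.inr a ∈ l) {u : U} (hu : u ∈ K a) (hlt : levels x₀ K l u < 1) :
    ∑ u', run (alg x₀) K l u' (Sum.inr a) = 1 := by
  obtain ⟨l', h1, h2⟩ := exists_run_eq_waterFill (x₀ := x₀) (K := K) hl ha
  simp only [h1, sum_waterFill]
  -- The water level used for `a` is at most the final level of its neighbour `u`, hence below `1`.
  exact sum_max_waterLevel_eq_one (levels_nonneg h0 l')
    ((waterLevel_le_add_waterFill hu).trans_lt ((h2 u).trans_lt hlt))

/-- The amounts assigned by adversarial nodes with a neighbour of final level at most `t` are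
poured below the height `t`. -/
theorem sum_run_le_min_sub_min [Fintype VA] {l : List (VP ⊕ VA)} (hl : l.Nodup) (t : ℝ)
    (N : Finset VA) (hN : ∀ a ∈ N, Sum.inr a ∈ l ∧ ∃ u ∈ K a, levels x₀ K l u ≤ t) (u : U) :
    ∑ a ∈ N, run (alg x₀) K l u (Sum.inr a) ≤
      min (levels x₀ K l u) t - min (∑ p, x₀ u p) t := by
  -- `N` varies because the last arrival is removed from it. Levels only grow, so the bound by `t`
  -- passes to shorter lists.
  induction l using List.reverseRecOn generalizing N with
  | nil =>
    have : N = ∅ := Finset.eq_empty_of_forall_notMem fun a ha => by simpa using (hN a ha).1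
    simp [this, levels_nil]
  | append_singleton l v ih =>
    obtain ⟨hl', -, hd⟩ := List.nodup_append.1 hl
    have hv : v ∉ l := fun h => hd v h v (by simp) rfl
    have hold : ∀ N' : Finset VA, (∀ a ∈ N', a ∈ N ∧ Sum.inr a ∈ l) →
        ∑ a ∈ N', run (alg x₀) K (l ++ [v]) u (Sum.inr a) ≤
          min (levels x₀ K l u) t - min (∑ p, x₀ u p) t := by
      intro N' hN'
      rw [Finset.sum_congr rfl fun a ha => run_append_of_mem _ K _ (hN' a ha).2 u]
      refine ih hl' N' fun a ha => ⟨(hN' a ha).2, ?_⟩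
      obtain ⟨u', hu', h⟩ := (hN a (hN' a ha).1).2
      exact ⟨u', hu', (levels_le_concat l v u').trans h⟩
    by_cases hvN : ∃ a ∈ N, v = Sum.inr a
    · obtain ⟨a, ha, rfl⟩ := hvN
      rw [← Finset.add_sum_erase N _ ha, run_alg_concat_inr hv]
      have := hold (N.erase a) fun b hb => by
        have hb' := Finset.mem_erase.1 hb
        refine ⟨hb'.2, ?_⟩
        have := (hN b hb'.2).1
        simpa [hb'.1] using this
      obtain ⟨u', hu', hle⟩ := (hN a ha).2
      rw [levels_concat_inr] at hle ⊢
      by_cases hw : waterFill (K a) (levels x₀ K l) u = 0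
      · simp only [hw]
        simpa using this
      · have hpos := waterFill_nonneg (K a) (levels x₀ K l) u
        -- A node receiving water from `a` stays at or below the neighbour `u'`, so truncation at
        -- `t` loses none of this increment.
        have h1 : levels x₀ K l u + waterFill (K a) (levels x₀ K l) u ≤ t :=
          (add_waterFill_le_waterLevel hw).trans ((waterLevel_le_add_waterFill hu').trans hle)
        simp only [min_eq_left h1]
        rw [min_eq_left (by linarith : levels x₀ K l u ≤ t)] at this
        linarith
    · refine (hold N fun a ha => ⟨ha, ?_⟩).trans
        (sub_le_sub_right (min_le_min_right _ (levels_le_concat l v u)) _)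
      rcases List.mem_append.1 (hN a ha).1 with h | h
      · exact h
      · exact absurd ⟨a, ha, (List.mem_singleton.1 h).symm⟩ hvN

end Run

/-! ### The covering inequality and the competitive ratio -/

section Competitive

variable {U VP VA : Type*} [DecidableEq U] [Fintype VP] [DecidableEq VP]
  [Fintype VA] [DecidableEq VA] {x₀ : U → VP → ℝ} {K : VA → Finset U} {l : List (VP ⊕ VA)}

theorem sum_run_eq_levels (hl : l.Nodup) (hmem : ∀ v, v ∈ l) (u : U) :
    ∑ v, run (alg x₀) K l u v = levels x₀ K l u := by
  rw [Fintype.sum_sum_type, levels_eq_sum hl]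
  simp [hmem, run_alg_inl]

variable [Fintype U] {H : VP → Finset U} {D : Skeleton H}

theorem isFractionalMatching_run (hx : IsFractionalMatching H x₀) (hl : l.Nodup)
    (hmem : ∀ v, v ∈ l) : IsFractionalMatching (fullGraph H K) (run (alg x₀) K l) := by
  refine ⟨fun u v => ?_, fun u v hu => ?_, fun u => ?_, fun v => ?_⟩
  · rcases v with p | a
    · exact hx.nonneg u p
    · exact waterFill_nonneg _ _ _
  · rcases v with p | a
    · exact hx.support u p hu
    · exact waterFill_of_notMem hu
  · rw [sum_run_eq_levels hl hmem]
    exact levels_le_one hx.nonneg hx.degree_offline l u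
  · rcases v with p | a
    · exact hx.degree_online p
    · obtain ⟨l', h1, -⟩ := exists_run_eq_waterFill (x₀ := x₀) (K := K) hl (hmem (Sum.inr a))
      simp only [h1, sum_waterFill]
      exact (waterLevel_mem (levels_nonneg hx.nonneg l')).2.2

/-- The covering inequality at height `t`: the nodes of final level above `t` together with the
online neighbours of the others form a vertex cover. -/
theorem matchingNumber_le_levels (hx : D.IsBalanced x₀) (hl : l.Nodup) (hmem : ∀ v, v ∈ l)
    {t : ℝ} (ht1 : t < 1) :
    (matchingNumber (fullGraph H K) : ℝ) ≤
      ((Finset.univ.filter fun u => t < levels x₀ K l u).card : ℝ)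
        + ∑ u, min (levels x₀ K l u) t
        - t * ((Finset.univ.filter fun u => t < ∑ p, x₀ u p).card : ℝ) := by
  have h0 := hx.isFractionalMatching.nonneg
  set A : Finset U := Finset.univ.filter fun u => t < levels x₀ K l u with hA
  set P : Finset VP := Finset.univ.filter fun p => ∃ u ∈ H p, levels x₀ K l u ≤ t with hP
  set N : Finset VA := Finset.univ.filter fun a => ∃ u ∈ K a, levels x₀ K l u ≤ t with hN
  have hcov : ∀ v, ∀ u ∈ fullGraph H K v, u ∈ A ∨ v ∈ P.disjSum N := by
    intro v u hu
    by_cases hut : t < levels x₀ K l u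
    · exact Or.inl (Finset.mem_filter.2 ⟨Finset.mem_univ _, hut⟩)
    · right
      rcases v with p | a
      · exact Finset.inl_mem_disjSum.2
          (Finset.mem_filter.2 ⟨Finset.mem_univ _, u, hu, not_lt.1 hut⟩)
      · exact Finset.inr_mem_disjSum.2
          (Finset.mem_filter.2 ⟨Finset.mem_univ _, u, hu, not_lt.1 hut⟩)
  have hcard : (matchingNumber (fullGraph H K) : ℝ) ≤ A.card + (P.card + N.card) := by
    have := matchingNumber_le_cover (fullGraph H K) A (P.disjSum N) hcov
    rw [Finset.card_disjSum] at this
    exact_mod_cast this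
  -- Nodes of `P` send mass only to initial levels at most `t`, so an offline node above `t`
  -- contributes `t - t = 0`. The terms `min (y₀ u) t` later cancel against those in `hNcard`.
  have hPcard : (P.card : ℝ) ≤
      ∑ u, (min (∑ p, x₀ u p) t - if t < ∑ p, x₀ u p then t else 0) := by
    have hP' : ∀ p ∈ P, ∑ u', x₀ u' p = 1 ∧ ∀ u', x₀ u' p ≠ 0 → ∑ p', x₀ u' p' ≤ t := by
      intro p hp
      obtain ⟨-, u, hu, hle⟩ := Finset.mem_filter.1 hp
      have hle' := (le_levels (x₀ := x₀) (K := K) l u).trans hle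
      obtain ⟨h1, h2⟩ := hx.of_degree_lt_one hu (hle'.trans_lt ht1)
      exact ⟨h1, fun u' hu' => (h2 u' hu').trans hle'⟩
    calc (P.card : ℝ) = ∑ p ∈ P, ∑ u, x₀ u p := by
          rw [Finset.sum_congr rfl fun p hp => (hP' p hp).1]
          simp
      _ = ∑ u, ∑ p ∈ P, x₀ u p := Finset.sum_comm
      _ ≤ _ := by
          refine Finset.sum_le_sum fun u _ => ?_
          split_ifs with hut
          · rw [min_eq_right hut.le, sub_self]
            refine (Finset.sum_eq_zero fun p hp => ?_).le
            by_contra h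
            exact absurd ((hP' p hp).2 u h) (not_le.2 hut)
          · rw [min_eq_left (not_lt.1 hut), sub_zero]
            exact Finset.sum_le_sum_of_subset_of_nonneg (Finset.subset_univ _)
              fun p _ _ => h0 u p
  have hNcard : (N.card : ℝ) ≤ ∑ u, (min (levels x₀ K l u) t - min (∑ p, x₀ u p) t) := by
    have hN' : ∀ a ∈ N, ∑ u', run (alg x₀) K l u' (Sum.inr a) = 1 := by
      intro a ha
      obtain ⟨-, u, hu, hle⟩ := Finset.mem_filter.1 ha
      exact sum_run_eq_one h0 hl (hmem _) hu (hle.trans_lt ht1)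
    calc (N.card : ℝ) = ∑ a ∈ N, ∑ u, run (alg x₀) K l u (Sum.inr a) := by
          rw [Finset.sum_congr rfl fun a ha => hN' a ha]
          simp
      _ = ∑ u, ∑ a ∈ N, run (alg x₀) K l u (Sum.inr a) := Finset.sum_comm
      _ ≤ _ := Finset.sum_le_sum fun u _ => sum_run_le_min_sub_min hl t N
          (fun a ha => ⟨hmem _, (Finset.mem_filter.1 ha).2⟩) u
  have hite : (∑ u, if t < ∑ p, x₀ u p then t else 0) =
      t * ((Finset.univ.filter fun u => t < ∑ p, x₀ u p).card : ℝ) := by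
    rw [← Finset.sum_filter, Finset.sum_const, nsmul_eq_mul, mul_comm]
  rw [Finset.sum_sub_distrib, hite] at hPcard
  rw [Finset.sum_sub_distrib] at hNcard
  linarith

theorem competitive_ratio (hx : D.IsBalanced x₀) (hl : l.Nodup) (hmem : ∀ v, v ∈ l) :
    (1 - delta H K * Real.exp (-delta H K)) * fractionalOpt (fullGraph H K) ≤
      value (run (alg x₀) K l) := by
  have hfm := isFractionalMatching_run (K := K) hx.isFractionalMatching hl hmem
  have hval : value (run (alg x₀) K l) = ∑ u, levels x₀ K l u :=
    Finset.sum_congr rfl fun u _ => sum_run_eq_levels hl hmem u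
  have hle : ∑ u, ∑ p, x₀ u p ≤ ∑ u, levels x₀ K l u :=
    Finset.sum_le_sum fun u _ => le_levels l u
  have hs : ∑ u, ∑ p, x₀ u p = matchingNumber H := hx.value_eq_matchingNumber
  have hopt := fractionalOpt_le_matchingNumber (fullGraph H K)
  set n : ℝ := (matchingNumber (fullGraph H K) : ℝ) with hn
  have hsn : ∑ u, ∑ p, x₀ u p ≤ n := hle.trans (hval ▸ hfm.value_le_matchingNumber)
  have hn0 : 0 ≤ n := Nat.cast_nonneg _
  have hs0 : (0 : ℝ) ≤ matchingNumber H := Nat.cast_nonneg _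
  set δ := delta H K with hδ
  have hδ' : δ = 1 - (matchingNumber H : ℝ) / n := rfl
  have hδ0 : 0 ≤ δ := by
    rw [hδ', ← hs]
    exact sub_nonneg.2 (div_le_one_of_le₀ hsn hn0)
  have hδ1 : δ ≤ 1 := by
    rw [hδ']
    exact sub_le_self _ (div_nonneg hs0 hn0)
  have hfactor : 0 ≤ 1 - δ * Real.exp (-δ) :=
    sub_nonneg.2 (mul_le_one₀ hδ1 (Real.exp_pos _).le (Real.exp_le_one_iff.2 (by linarith)))
  refine (mul_le_mul_of_nonneg_left hopt hfactor).trans ?_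
  rw [hval]
  -- For `n = 0` the bound is trivial; otherwise `n - s = δ n` turns the level inequality into the
  -- claimed ratio.
  rcases hn0.eq_or_lt with h | hpos
  · rw [← h, mul_zero]
    exact (hs ▸ hs0).trans hle
  · have := le_sum_levels n (fun u => ∑ p, x₀ u p) (levels x₀ K l) hpos
      (fun u => Finset.sum_nonneg fun p _ => hx.isFractionalMatching.nonneg u p)
      (fun u => le_levels l u)
      (fun u => levels_le_one hx.isFractionalMatching.nonneg
        hx.isFractionalMatching.degree_offline l u)
      hsn (fun t _ => matchingNumber_le_levels hx hl hmem)
    rw [hs, ← hδ'] at this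
    have hnδ : n - (matchingNumber H : ℝ) = δ * n := by rw [hδ']; field_simp
    rw [hnδ] at this
    linarith

end Competitive

end SemiOnline

theorem mainTheorem4 {U : Type*} {VP : Type*} {VA : Type*}
    [Fintype U] [DecidableEq U] [Fintype VP] [DecidableEq VP] [Fintype VA] [DecidableEq VA]
    (H : VP → Finset U) :
    (∃ (D : SemiOnline.Skeleton H) (x₀ : U → VP → ℝ), D.IsBalanced x₀) ∧
    ∀ (D : SemiOnline.Skeleton H) (x₀ : U → VP → ℝ), D.IsBalanced x₀ →
      ∀ (K : VA → Finset U) (l : List (VP ⊕ VA)), l.Nodup → (∀ v, v ∈ l) →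
        SemiOnline.IsFractionalMatching (SemiOnline.fullGraph H K)
          (SemiOnline.run (SemiOnline.alg x₀) K l) ∧
        (1 - SemiOnline.delta H K * Real.exp (-SemiOnline.delta H K)) *
            SemiOnline.fractionalOpt (SemiOnline.fullGraph H K) ≤
          SemiOnline.value (SemiOnline.run (SemiOnline.alg x₀) K l) :=
  ⟨SemiOnline.exists_skeleton_isBalanced H, fun _ _ hx _ _ hl hmem =>
    ⟨SemiOnline.isFractionalMatching_run hx.isFractionalMatching hl hmem,
      SemiOnline.competitive_ratio hx hl hmem⟩⟩
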